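/- Let $R$ be a complete discrete valuation ring with maximal ideal $\mathfrak m$ and residue field $k$, let $n\ge 0$, and put $R_n=R/\mathfrak m^{n+1}$. **Definition of $\widetilde{\mathcal R}_n$ in mixed characteristic.** Suppose that $\operatorname{char} R=0$ and that $k$ is perfect of characteristic $p>0$, so that $R$ is canonically an algebra over the ring $W(k)$ of $p$-typical Witt vectors. For a $k$-algebra $A$ put $\mathcal R(A)=W(A)\otimes_{W(k)}R$. For $m\ge 0$ let $\mathcal R^m(A)\subset\mathcal R(A)$ be the ideal generated by the elements $V^j(a)\otimes r$ with $j\ge 0$, $a\in W(A)$, $r\in R$ and $p^jr\in\mathfrak m^m$, where $V$ is the Verschiebung. (If $\omega$ is a uniformizer of $R$ and $e=\operatorname{ord}_R(p)$, then $\mathcal R(A)=\bigoplus_{i<e}W(A)\,\omega^i$ and $\mathcal R^m(A)=\bigoplus_{i<e}V^{m_i}W(A)\,\omega^i$ with $m_i=\max(0,\lceil (m-i)/e\rceil)$.) Then $\mathcal R_n(A)=\mathcal R(A)/\mathcal R^{n+1}(A)$ defines a ring scheme $\mathcal R_n$ over $k$ with $\mathcal R_n(k)=R_n$, and $a\otimes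 r\mapsto a_0\bar r$ defines a surjection $\mathcal R_n(A)\to A$. For a $k$-scheme $X$ let $\widetilde{\mathcal R}_n(X)$ be the ringed space with underlying space $|X|$ and structure sheaf $U\mapsto\mathcal R_n(\Gamma(U,\mathcal O_X))$, and let $X\to\widetilde{\mathcal R}_n(X)$ be the morphism given by the identity of $|X|$ and the surjections above. **Definition of $\widetilde{\mathcal R}_n$ in equal characteristic.** Suppose that $R$ has a coefficient field, that is, a homomorphism $\sigma:k\to R$ that is a section of $R\to k$. Regard $R_n$ as a $k$-algebra through $\sigma$, put $\widetilde{\mathcal R}_n(X)=X\times_{\operatorname{Spec}k}\operatorname{Spec}R_n$ for a $k$-scheme $X$, and let $X\to\widetilde{\mathcal R}_n(X)$ be the base change of $\operatorname{Spec}k\to\operatorname{Spec}R_n$. **Proposition.** In both cases the following holds. 1. For every $k$-scheme $X$, $\widetilde{\mathcal R}_n(X)$ is a scheme. In mixed characteristic, if $X=\operatorname{Spec}A$ is affine, then $\widetilde{\mathcal R}_n(X)$ is affine, so that $\widetilde{\mathcal R}_n(X)=\operatorname{Spec}\mathcal R_n(A)$. 2. If $X\to Y$ is an étale morphism of $k$-schemes,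 then $\widetilde{\mathcal R}_n(X)\to\widetilde{\mathcal R}_n(Y)$ and the maps $X\to\widetilde{\mathcal R}_n(X)$, $Y\to\widetilde{\mathcal R}_n(Y)$ are morphisms of schemes, the morphism $\widetilde{\mathcal R}_n(X)\to\widetilde{\mathcal R}_n(Y)$ is étale, and the square $$\begin{array}{ccc}X&\longrightarrow&\widetilde{\mathcal R}_n(X)\\ \downarrow&&\downarrow\\ Y&\longrightarrow&\widetilde{\mathcal R}_n(Y)\end{array}$$ is cartesian. -/

import Mathlib

open CategoryTheory AlgebraicGeometry TopologicalSpace Opposite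
open scoped TensorProduct

universe u

noncomputable section

namespace Greenberg

/-! ### The canonical homomorphism `W(k) → R` -/

section WittLift

variable (p : ℕ) (R : Type u) [CommRing R] [IsLocalRing R]
  [CharP (IsLocalRing.ResidueField R) p]

theorem natCast_mem_maximalIdeal : (p : R) ∈ IsLocalRing.maximalIdeal R := by
  rw [← IsLocalRing.residue_eq_zero_iff, map_natCast, CharP.cast_eq_zero]

variable [Fact p.Prime]

theorem ker_map_residue_le (n : ℕ) :
    RingHom.ker (WittVector.map (p := p) (IsLocalRing.residue R)) ≤
      RingHom.ker ((Ideal.Quotient.mk (IsLocalRing.maximalIdeal R ^ (n + 1))).comp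
        (WittVector.ghostComponent (p := p) n)) := by
  intro x hx
  rw [RingHom.mem_ker, WittVector.map_eq_zero_iff] at hx
  rw [RingHom.mem_ker, RingHom.comp_apply, Ideal.Quotient.eq_zero_iff_mem,
    WittVector.ghostComponent_apply, aeval_wittPolynomial]
  refine Ideal.sum_mem _ fun i hi => ?_
  have hp : (p : R) ^ i ∈ IsLocalRing.maximalIdeal R ^ i :=
    Ideal.pow_mem_pow (natCast_mem_maximalIdeal p R) i
  have hc : x.coeff i ^ p ^ (n - i) ∈ IsLocalRing.maximalIdeal R ^ (p ^ (n - i)) :=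
    Ideal.pow_mem_pow ((IsLocalRing.residue_eq_zero_iff _).1 (hx i)) _
  have hle : n + 1 ≤ i + p ^ (n - i) := by
    have := Nat.lt_pow_self (n := n - i) (Fact.out : p.Prime).one_lt
    omega
  have := Ideal.mul_mem_mul hp hc
  rw [← pow_add] at this
  exact Ideal.pow_le_pow_right hle this

/-- The homomorphism `W(k) → R / 𝔪 ^ (n + 1)` that sends `(ā₀, ā₁, …)` to
`∑ i ≤ n, p ^ i * aᵢ ^ (p ^ (n - i))`, where `k` is the residue field. -/
def ghostMod (n : ℕ) :
    WittVector p (IsLocalRing.ResidueField R) →+*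
      R ⧸ IsLocalRing.maximalIdeal R ^ (n + 1) :=
  RingHom.liftOfSurjective (WittVector.map (IsLocalRing.residue R))
    (WittVector.map_surjective _ IsLocalRing.residue_surjective)
    ⟨(Ideal.Quotient.mk (IsLocalRing.maximalIdeal R ^ (n + 1))).comp
      (WittVector.ghostComponent n), ker_map_residue_le p R n⟩

theorem ghostMod_map (n : ℕ) (x : WittVector p R) :
    ghostMod p R n (WittVector.map (IsLocalRing.residue R) x) =
      Ideal.Quotient.mk _ (WittVector.ghostComponent n x) :=
  RingHom.liftOfSurjective_comp_apply ..

variable [PerfectRing (IsLocalRing.ResidueField R) p]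

/-- The homomorphism `W(k) → R / 𝔪 ^ (n + 1)` that sends `(ā₀ ^ (p ^ n), ā₁ ^ (p ^ n), …)` to
`∑ i ≤ n, p ^ i * aᵢ ^ (p ^ (n - i))`; it lifts the identity of `k`. -/
def wittLiftMod (n : ℕ) :
    WittVector p (IsLocalRing.ResidueField R) →+*
      R ⧸ IsLocalRing.maximalIdeal R ^ (n + 1) :=
  (ghostMod p R n).comp (WittVector.map
    (((frobeniusEquiv (IsLocalRing.ResidueField R) p).symm ^ n :
      IsLocalRing.ResidueField R ≃+* IsLocalRing.ResidueField R) :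
      IsLocalRing.ResidueField R →+* IsLocalRing.ResidueField R))

theorem factorPowSucc_comp_wittLiftMod (n : ℕ) :
    (Ideal.Quotient.factorPowSucc (IsLocalRing.maximalIdeal R) (n + 1)).comp
      (wittLiftMod p R (n + 1)) = wittLiftMod p R n := by
  ext x
  obtain ⟨a, ha⟩ := WittVector.map_surjective (p := p) _
    (IsLocalRing.residue_surjective (R := R))
    (WittVector.map (((frobeniusEquiv (IsLocalRing.ResidueField R) p).symm ^ (n + 1) :
      IsLocalRing.ResidueField R ≃+* IsLocalRing.ResidueField R) :
      IsLocalRing.ResidueField R →+* IsLocalRing.ResidueField R) x)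
  have hb : WittVector.map (IsLocalRing.residue R) (WittVector.mk p fun i => a.coeff i ^ p) =
      WittVector.map (((frobeniusEquiv (IsLocalRing.ResidueField R) p).symm ^ n :
        IsLocalRing.ResidueField R ≃+* IsLocalRing.ResidueField R) :
        IsLocalRing.ResidueField R →+* IsLocalRing.ResidueField R) x := by
    ext i
    have hi := congrArg (fun w => WittVector.coeff w i) ha
    simp only [WittVector.map_coeff] at hi
    simp only [WittVector.map_coeff, WittVector.coeff_mk, map_pow] at hi ⊢
    rw [hi, ← frobenius_def, ← frobeniusEquiv_apply, RingEquiv.coe_toRingHom,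
      RingEquiv.coe_toRingHom, pow_succ', RingAut.mul_apply, RingEquiv.apply_symm_apply]
  rw [RingHom.comp_apply, wittLiftMod, wittLiftMod, RingHom.comp_apply, RingHom.comp_apply,
    ← ha, ← hb, ghostMod_map, ghostMod_map, Ideal.Quotient.factor_mk, Ideal.Quotient.eq,
    WittVector.ghostComponent_apply, WittVector.ghostComponent_apply, aeval_wittPolynomial,
    aeval_wittPolynomial, Finset.sum_range_succ]
  have hs : ∑ i ∈ Finset.range (n + 1), (p : R) ^ i * a.coeff i ^ p ^ (n + 1 - i) =
      ∑ i ∈ Finset.range (n + 1),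
        (p : R) ^ i * (WittVector.mk p fun i => a.coeff i ^ p).coeff i ^ p ^ (n - i) := by
    refine Finset.sum_congr rfl fun i hi => ?_
    have : n + 1 - i = n - i + 1 := by
      have := Finset.mem_range.1 hi
      omega
    rw [WittVector.coeff_mk, this, pow_succ', pow_mul]
  rw [hs, add_sub_cancel_left]
  exact Ideal.mul_mem_right _ _ (Ideal.pow_mem_pow (natCast_mem_maximalIdeal p R) _)

variable [IsAdicComplete (IsLocalRing.maximalIdeal R) R]

/-- The canonical homomorphism `W(k) → R` of a complete local ring `R` with perfect residue field
`k` of characteristic `p`: the unique one that lifts the identity of `k`. -/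
def wittLift : WittVector p (IsLocalRing.ResidueField R) →+* R :=
  IsAdicComplete.StrictMono.liftRingHom (IsLocalRing.maximalIdeal R) Order.succ_strictMono _
    (factorPowSucc_comp_wittLiftMod p R _)

theorem residue_wittLift (x : WittVector p (IsLocalRing.ResidueField R)) :
    IsLocalRing.residue R (wittLift p R x) = x.coeff 0 := by
  have h : Ideal.Quotient.mk (IsLocalRing.maximalIdeal R ^ (0 + 1)) (wittLift p R x) =
      wittLiftMod p R 0 x :=
    IsAdicComplete.StrictMono.mk_liftRingHom (IsLocalRing.maximalIdeal R) Order.succ_strictMono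
      _ (factorPowSucc_comp_wittLiftMod p R _) x
  obtain ⟨a, rfl⟩ := WittVector.map_surjective (p := p) _
    (IsLocalRing.residue_surjective (R := R)) x
  have h1 : wittLiftMod p R 0 (WittVector.map (IsLocalRing.residue R) a) =
      ghostMod p R 0 (WittVector.map (IsLocalRing.residue R) a) := by
    rw [wittLiftMod, RingHom.comp_apply]
    congr 1
  rw [h1, ghostMod_map, Ideal.Quotient.eq, zero_add, pow_one,
    ← IsLocalRing.residue_eq_zero_iff, map_sub, sub_eq_zero] at h
  rw [h, WittVector.map_coeff]
  simp [WittVector.ghostComponent_apply]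

end WittLift

/-! ### The rings `𝓡_n(A)` in mixed characteristic -/

section WittThickening

variable (p : ℕ) [Fact p.Prime] (R : Type u) [CommRing R] [IsLocalRing R]
  [CharP (IsLocalRing.ResidueField R) p] [PerfectRing (IsLocalRing.ResidueField R) p]
  [IsAdicComplete (IsLocalRing.maximalIdeal R) R]

/-- `R` as an algebra over `W(k)`. -/
abbrev wittAlgebra : Algebra (WittVector p (IsLocalRing.ResidueField R)) R :=
  (wittLift p R).toAlgebra

/-- `W(A)` as an algebra over `W(k)`, for a ring `A` over `k`. -/
abbrev wittMapAlgebra {k A : Type u} [CommRing k] [CommRing A] (s : k →+* A) :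
    Algebra (WittVector p k) (WittVector p A) :=
  (WittVector.map s).toAlgebra

variable {A : Type u} [CommRing A] (s : IsLocalRing.ResidueField R →+* A)

/-- The ring `𝓡(A) = W(A) ⊗_{W(k)} R`, for a ring `A` over `k`. -/
abbrev WittExt : Type u :=
  letI := wittAlgebra p R
  letI := wittMapAlgebra p s
  WittVector p A ⊗[WittVector p (IsLocalRing.ResidueField R)] R

/-- The elementary tensor `a ⊗ r` of `𝓡(A)`. -/
def WittExt.tmul (a : WittVector p A) (r : R) : WittExt p R s :=
  letI := wittAlgebra p R
  letI := wittMapAlgebra p s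
  a ⊗ₜ[WittVector p (IsLocalRing.ResidueField R)] r

/-- The ideal `𝓡^m(A)` of `𝓡(A)`, generated by the elements `V^j(a) ⊗ r` with
`j * ord(p) + ord(r) ≥ m`, where `V` is the Verschiebung. If `R` is a discrete valuation ring with
uniformizer `ω` and `e = ord(p)` is finite, then `𝓡(A)` is free over `W(A)` with basis
`1, ω, …, ω ^ (e - 1)` and `𝓡^m(A) = ⨁ i < e, V^{m_i}W(A) ⊗ ω ^ i`, where `m_i` is the least
natural number such that `i + m_i * e ≥ m`. -/
def wittFil (m : ℕ) : Ideal (WittExt p R s) :=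
  Ideal.span {x | ∃ (j : ℕ) (a : WittVector p A) (r : R),
    (p : R) ^ j * r ∈ IsLocalRing.maximalIdeal R ^ m ∧
      x = WittExt.tmul p R s (WittVector.verschiebung^[j] a) r}

/-- The ring `𝓡_n(A) = 𝓡(A) / 𝓡^{n + 1}(A)`. -/
abbrev WittThickening (n : ℕ) : Type u :=
  WittExt p R s ⧸ wittFil p R s (n + 1)

/-- The homomorphism from `𝓡(A)` to a ring `C` that is given by compatible homomorphisms on
`W(A)` and on `R`. -/
def WittExt.lift {C : Type u} [CommRing C] (f : WittVector p A →+* C) (g : R →+* C)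
    (h : f.comp (WittVector.map s) = g.comp (wittLift p R)) : WittExt p R s →+* C :=
  letI := wittAlgebra p R
  letI := wittMapAlgebra p s
  letI : Algebra (WittVector p (IsLocalRing.ResidueField R)) C :=
    (g.comp (wittLift p R)).toAlgebra
  (Algebra.TensorProduct.lift
    (⟨f, fun x => RingHom.congr_fun h x⟩ :
      WittVector p A →ₐ[WittVector p (IsLocalRing.ResidueField R)] C)
    (⟨g, fun _ => rfl⟩ : R →ₐ[WittVector p (IsLocalRing.ResidueField R)] C)
    (fun _ _ => mul_comm _ _)).toRingHom

theorem WittExt.lift_tmul {C : Type u} [CommRing C] (f : WittVector p A →+* C) (g : R →+* C)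
    (h : f.comp (WittVector.map s) = g.comp (wittLift p R)) (a : WittVector p A) (r : R) :
    WittExt.lift p R s f g h (WittExt.tmul p R s a r) = f a * g r := rfl

theorem WittExt.hom_ext {C : Type u} [CommRing C] {f g : WittExt p R s →+* C}
    (h : ∀ a r, f (WittExt.tmul p R s a r) = g (WittExt.tmul p R s a r)) : f = g := by
  let := wittAlgebra p R
  let := wittMapAlgebra p s
  refine RingHom.ext fun x => ?_
  induction x using TensorProduct.induction_on with
  | zero => rw [map_zero, map_zero]
  | tmul a r => exact h a r
  | add x y hx hy => rw [map_add, map_add, hx, hy]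

/-- The structural homomorphism `a ↦ a ⊗ 1` from `W(A)` to `𝓡(A)`. -/
def WittExt.inclW : WittVector p A →+* WittExt p R s :=
  letI := wittAlgebra p R
  letI := wittMapAlgebra p s
  Algebra.TensorProduct.includeLeftRingHom

/-- The structural homomorphism `r ↦ 1 ⊗ r` from `R` to `𝓡(A)`. -/
def WittExt.inclR : R →+* WittExt p R s :=
  letI := wittAlgebra p R
  letI := wittMapAlgebra p s
  (Algebra.TensorProduct.includeRight :
    R →ₐ[WittVector p (IsLocalRing.ResidueField R)] WittExt p R s).toRingHom

theorem WittExt.inclW_mul_inclR (a : WittVector p A) (r : R) :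
    WittExt.inclW p R s a * WittExt.inclR p R s r = WittExt.tmul p R s a r := by
  let := wittAlgebra p R
  let := wittMapAlgebra p s
  exact (Algebra.TensorProduct.tmul_mul_tmul a 1 1 r).trans (by rw [mul_one, one_mul]; rfl)

theorem WittExt.inclW_comp :
    (WittExt.inclW p R s).comp (WittVector.map s) = (WittExt.inclR p R s).comp (wittLift p R) := by
  let := wittAlgebra p R
  let := wittMapAlgebra p s
  exact RingHom.ext fun x =>
    (Algebra.TensorProduct.includeRight :
      R →ₐ[WittVector p (IsLocalRing.ResidueField R)] WittExt p R s).commutes x |>.symm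

variable {B : Type u} [CommRing B] {s} {s' : IsLocalRing.ResidueField R →+* B}

/-- `𝓡(A) → 𝓡(B)`, `a ⊗ r ↦ W(t)(a) ⊗ r`, for a homomorphism `t : A → B` over `k`. -/
def WittExt.map (t : A →+* B) (ht : t.comp s = s') : WittExt p R s →+* WittExt p R s' :=
  WittExt.lift p R s ((WittExt.inclW p R s').comp (WittVector.map t)) (WittExt.inclR p R s') (by
    rw [← WittExt.inclW_comp, ← ht]
    rfl)

theorem WittExt.map_tmul (t : A →+* B) (ht : t.comp s = s') (a : WittVector p A) (r : R) :
    WittExt.map p R t ht (WittExt.tmul p R s a r) =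
      WittExt.tmul p R s' (WittVector.map t a) r := by
  rw [← WittExt.inclW_mul_inclR p R s' (WittVector.map t a) r]
  rfl

theorem WittExt.map_eq_id (t : A →+* A) (ht : t.comp s = s) (h : t = RingHom.id A) :
    WittExt.map p R t ht = RingHom.id _ := by
  subst h
  refine WittExt.hom_ext p R _ fun a r => ?_
  rw [WittExt.map_tmul, WittVector.map_id]
  rfl

theorem WittExt.map_eq_comp {C : Type u} [CommRing C] {s'' : IsLocalRing.ResidueField R →+* C}
    (t : A →+* B) (ht : t.comp s = s') (t' : B →+* C) (ht' : t'.comp s' = s'')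
    (u : A →+* C) (hu : u.comp s = s'') (h : u = t'.comp t) :
    WittExt.map p R u hu = (WittExt.map p R t' ht').comp (WittExt.map p R t ht) := by
  subst h
  refine WittExt.hom_ext p R _ fun a r => ?_
  rw [RingHom.comp_apply, WittExt.map_tmul, WittExt.map_tmul, WittExt.map_tmul]
  rfl

theorem map_iterate_verschiebung (t : A →+* B) (j : ℕ) (a : WittVector p A) :
    WittVector.map t (WittVector.verschiebung^[j] a) =
      WittVector.verschiebung^[j] (WittVector.map t a) := by
  induction j with
  | zero => rfl
  | succ j ih =>
    rw [Function.iterate_succ_apply', Function.iterate_succ_apply', WittVector.map_verschiebung, ih]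

theorem wittFil_le_comap (t : A →+* B) (ht : t.comp s = s') (m : ℕ) :
    wittFil p R s m ≤ (wittFil p R s' m).comap (WittExt.map p R t ht) := by
  refine Ideal.span_le.2 ?_
  rintro _ ⟨j, a, r, hr, rfl⟩
  refine Ideal.subset_span ⟨j, WittVector.map t a, r, hr, ?_⟩
  rw [WittExt.map_tmul, map_iterate_verschiebung]

/-- `𝓡_n(A) → 𝓡_n(B)`, for a homomorphism `t : A → B` over `k`. -/
def WittThickening.map (t : A →+* B) (ht : t.comp s = s') (n : ℕ) :
    WittThickening p R s n →+* WittThickening p R s' n :=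
  Ideal.quotientMap _ (WittExt.map p R t ht) (wittFil_le_comap p R t ht (n + 1))

variable (s)

/-- The homomorphism `𝓡(A) → A`, `a ⊗ r ↦ a₀ * r̄`. -/
def WittExt.reduction : WittExt p R s →+* A :=
  WittExt.lift p R s WittVector.constantCoeff (s.comp (IsLocalRing.residue R)) (by
    ext x
    simp [residue_wittLift, WittVector.constantCoeff])

theorem WittExt.reduction_tmul (a : WittVector p A) (r : R) :
    WittExt.reduction p R s (WittExt.tmul p R s a r) =
      a.coeff 0 * s (IsLocalRing.residue R r) := rfl

theorem wittFil_le_ker (n : ℕ) :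
    wittFil p R s (n + 1) ≤ RingHom.ker (WittExt.reduction p R s) := by
  refine Ideal.span_le.2 ?_
  rintro _ ⟨j, a, r, hr, rfl⟩
  rw [SetLike.mem_coe, RingHom.mem_ker, WittExt.reduction_tmul]
  cases j with
  | zero =>
    rw [pow_zero, one_mul] at hr
    have hr' : r ∈ IsLocalRing.maximalIdeal R := Ideal.pow_le_self n.succ_ne_zero hr
    rw [(IsLocalRing.residue_eq_zero_iff r).2 hr', map_zero, mul_zero]
  | succ j =>
    rw [Function.iterate_succ_apply', WittVector.verschiebung_coeff_zero, zero_mul]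

/-- The reduction `𝓡_n(A) → A`, that is, the transition map `𝓡_n → 𝓡_0`, where `𝓡_0(A)` is
identified with `A`. -/
def WittThickening.reduction (n : ℕ) : WittThickening p R s n →+* A :=
  Ideal.Quotient.lift _ (WittExt.reduction p R s) (fun _ hx => wittFil_le_ker p R s n hx)

theorem WittExt.reduction_comp_map (t : A →+* B) (ht : t.comp s = s') :
    (WittExt.reduction p R s').comp (WittExt.map p R t ht) =
      t.comp (WittExt.reduction p R s) := by
  subst ht
  refine WittExt.hom_ext p R _ fun a r => ?_
  rw [RingHom.comp_apply, RingHom.comp_apply, WittExt.map_tmul, WittExt.reduction_tmul,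
    WittExt.reduction_tmul, map_mul, WittVector.map_coeff]
  rfl

/-- The ring scheme `𝓡_n` over `k` in mixed characteristic, as a functor from `k`-algebras to
rings. -/
def wittFunctor (n : ℕ) :
    Under (CommRingCat.of (IsLocalRing.ResidueField R)) ⥤ CommRingCat.{u} where
  obj A := CommRingCat.of (WittThickening p R A.hom.hom n)
  map {A B} t := CommRingCat.ofHom
    (WittThickening.map p R t.right.hom (congrArg CommRingCat.Hom.hom (Under.w t)) n)
  map_id A := by
    refine CommRingCat.hom_ext (Ideal.Quotient.ringHom_ext (RingHom.ext fun x => ?_))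
    exact congrArg (Ideal.Quotient.mk _)
      (RingHom.congr_fun (WittExt.map_eq_id p R _ _ rfl) x)
  map_comp {A B C} t t' := by
    refine CommRingCat.hom_ext (Ideal.Quotient.ringHom_ext (RingHom.ext fun x => ?_))
    exact congrArg (Ideal.Quotient.mk _)
      (RingHom.congr_fun (WittExt.map_eq_comp p R t.right.hom _ t'.right.hom
        (congrArg CommRingCat.Hom.hom (Under.w t')) _ _ rfl) x)

/-- The reductions `𝓡_n(A) → A` as a natural transformation. -/
def wittReduction (n : ℕ) : wittFunctor p R n ⟶ Under.forget _ where
  app A := CommRingCat.ofHom (WittThickening.reduction p R A.hom.hom n)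
  naturality A B t := by
    refine CommRingCat.hom_ext (Ideal.Quotient.ringHom_ext (RingHom.ext fun x => ?_))
    exact RingHom.congr_fun (WittExt.reduction_comp_map p R A.hom.hom t.right.hom
      (congrArg CommRingCat.Hom.hom (Under.w t))) x

end WittThickening

/-! ### The functor `X ↦ (|X|, 𝓡_n(𝒪_X))` -/

section Tilde

variable {k : CommRingCat.{u}}

/-- The structure sheaf of a scheme over `Spec k` as a presheaf of rings under `k`. -/
def sectionsUnder (X : Over (Spec k)) : (Opens X.left)ᵒᵖ ⥤ Under k :=
  Functor.toUnder X.left.presheaf k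
    (fun U => (Scheme.ΓSpecIso k).inv ≫ X.hom.appTop ≫
      X.left.presheaf.map (homOfLE (le_top : U.unop ≤ ⊤)).op)
    (fun g => by
      rw [Category.assoc, Category.assoc, ← Functor.map_comp]
      rfl)

/-- The underlying ringed space of a scheme. -/
abbrev schemeToPresheafedSpace : Scheme.{u} ⥤ PresheafedSpace.{_, _, u} CommRingCat.{u} :=
  Scheme.forgetToLocallyRingedSpace ⋙ LocallyRingedSpace.forgetToSheafedSpace ⋙
    SheafedSpace.forgetToPresheafedSpace

variable (F : Under k ⥤ CommRingCat.{u})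

/-- The map on sections induced by a morphism of schemes over `Spec k`. -/
def sectionsUnderMap {X Y : Over (Spec k)} (f : X ⟶ Y) :
    sectionsUnder Y ⟶ (Opens.map f.left.base).op ⋙ sectionsUnder X where
  app U := Under.homMk (f.left.app U.unop) (by
    change ((Scheme.ΓSpecIso k).inv ≫ Y.hom.appTop ≫ Y.left.presheaf.map _) ≫ _ =
      (Scheme.ΓSpecIso k).inv ≫ X.hom.appTop ≫ X.left.presheaf.map _
    rw [← Over.w f, Scheme.Hom.comp_appTop, Category.assoc, Category.assoc, Category.assoc,
      Scheme.Hom.naturality]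
    rfl)
  naturality U V g := by
    ext1
    exact f.left.toLRSHom.c.naturality g

/-- For a functor `F` from `k`-algebras to rings, the functor that sends a scheme `X` over `k` to
the ringed space with underlying space `|X|` and ring of sections `F(Γ(X, U))` over `U`. -/
def tilde : Over (Spec k) ⥤ PresheafedSpace.{_, _, u} CommRingCat.{u} where
  obj X := ⟨X.left.carrier, sectionsUnder X ⋙ F⟩
  map {X Y} f :=
    { base := f.left.base
      c := Functor.whiskerRight (sectionsUnderMap f) F }
  map_id X := by
    refine PresheafedSpace.hext _ _ rfl (heq_of_eq ?_)
    refine NatTrans.ext (funext fun U => ?_)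
    exact F.map_id _
  map_comp f g := by
    refine PresheafedSpace.hext _ _ rfl (heq_of_eq ?_)
    refine NatTrans.ext (funext fun U => ?_)
    exact F.map_comp ((sectionsUnderMap g).app U)
      ((sectionsUnderMap f).app ((Opens.map g.left.base).op.obj U))

/-- The morphism from `X` to the ringed space `(|X|, F(𝒪_X))` that is the identity on `|X|` and
`ε : F(Γ(X, U)) → Γ(X, U)` on sections, as a natural transformation. -/
def tildeIncl (ε : F ⟶ Under.forget k) :
    Over.forget (Spec k) ⋙ schemeToPresheafedSpace ⟶ tilde F where
  app X :=
    { base := 𝟙 X.left.carrier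
      c := Functor.whiskerLeft (sectionsUnder X) ε }
  naturality X Y f := by
    refine PresheafedSpace.hext _ _ rfl (heq_of_eq ?_)
    refine NatTrans.ext (funext fun U => ?_)
    exact (ε.naturality ((sectionsUnderMap f).app U)).symm

end Tilde

/-! ### Equal characteristic -/

section EqualChar

variable {R : Type u} [CommRing R] [IsLocalRing R]

/-- `Spec (R / 𝔪 ^ (n + 1)) → Spec k`, for a homomorphism `σ : k → R`. -/
def coeffSpec (σ : IsLocalRing.ResidueField R →+* R) (n : ℕ) :
    Spec (CommRingCat.of (R ⧸ IsLocalRing.maximalIdeal R ^ (n + 1))) ⟶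
      Spec (CommRingCat.of (IsLocalRing.ResidueField R)) :=
  Spec.map (CommRingCat.ofHom ((Ideal.Quotient.mk _).comp σ))

variable (R) in
/-- The closed immersion `Spec k → Spec (R / 𝔪 ^ (n + 1))`. -/
def residueSpec (n : ℕ) :
    Spec (CommRingCat.of (IsLocalRing.ResidueField R)) ⟶
      Spec (CommRingCat.of (R ⧸ IsLocalRing.maximalIdeal R ^ (n + 1))) :=
  Spec.map (CommRingCat.ofHom (Ideal.Quotient.lift _ (IsLocalRing.residue R)
    (fun _ hx => (IsLocalRing.residue_eq_zero_iff _).2 (Ideal.pow_le_self n.succ_ne_zero hx))))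

theorem residueSpec_comp_coeffSpec (σ : IsLocalRing.ResidueField R →+* R)
    (hσ : ∀ x, IsLocalRing.residue R (σ x) = x) (n : ℕ) :
    residueSpec R n ≫ coeffSpec σ n = 𝟙 _ := by
  rw [residueSpec, coeffSpec, ← Spec.map_comp, ← CommRingCat.ofHom_comp, ← Spec.map_id]
  congr 1
  exact CommRingCat.hom_ext (RingHom.ext hσ)

/-- The functor `X ↦ X ×_{Spec k} Spec (R / 𝔪 ^ (n + 1))`. -/
def equalTilde (σ : IsLocalRing.ResidueField R →+* R) (n : ℕ) :
    Over (Spec (CommRingCat.of (IsLocalRing.ResidueField R))) ⥤ Scheme.{u} :=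
  Over.pullback (coeffSpec σ n) ⋙ Over.forget _

/-- The base change `X → X ×_{Spec k} Spec (R / 𝔪 ^ (n + 1))` of the closed immersion
`Spec k → Spec (R / 𝔪 ^ (n + 1))`. -/
def equalTildeIncl (σ : IsLocalRing.ResidueField R →+* R)
    (hσ : ∀ x, IsLocalRing.residue R (σ x) = x) (n : ℕ)
    (X : Over (Spec (CommRingCat.of (IsLocalRing.ResidueField R)))) :
    X.left ⟶ (equalTilde σ n).obj X :=
  Limits.pullback.lift (𝟙 X.left) (X.hom ≫ residueSpec R n) (by
    rw [Category.assoc, residueSpec_comp_coeffSpec σ hσ, Category.id_comp, Category.comp_id])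

end EqualChar

end Greenberg

end

/-! In equal characteristic everything is base change: étaleness is stable under it, and the square
is pasted with the projections to `X` and `Y`. The content lies in mixed characteristic, where
`𝓡_n(A)` is not a base change of `A`.

Let `ϖ` be a uniformizer and `e` the ramification index. Since `R` is free over `W(k)` on `1, …, ϖ ^
(e - 1)`, an element of `𝓡_n(A)` amounts to `n + 1` arbitrary coordinates in `A`, naturally in `A`:
for `l = i + t * e` with `i < e`, the `l`-th one is the `t`-th Witt component of the coefficient of
`ϖ ^ i`. The graded pieces of the filtration by the ideals `𝓡^m(A)` are copies of `A` on which `y`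
acts as the `p ^ (m / e)`-th power of its reduction, because `V^t(a) * b = V^t(a * F^t(b))`
(`coord_mul`). In particular the reduction `𝓡_n(A) → A` has nilpotent kernel.

Now let `A → B` be étale. Lift `B` to an étale algebra `C` over `𝓡_n(A)` (`exists_etale_lift`), and
lift `C → B` to `ψ : C → 𝓡_n(B)` by formal smoothness. The `m`-th graded piece of `C` for the
induced filtration is a quotient of `A' ⊗[A] B`, where `A'` is `A` with `A` acting through `p ^ (m /
e)`-th powers. The relative Frobenius `A' ⊗[A] B → B'` of an étale algebra is bijective
(`bijective_relFrobenius`), so `ψ` is bijective on graded pieces, hence bijective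
(`bijective_of_etale`). Thus `𝓡_n` preserves étale homomorphisms. The same argument with a
localization of `𝓡_n(A)` in place of `C` shows that it preserves localizations at one element.

The geometry uses only the properties collected in `IsThickening`. Coordinates give the sheaf
property, nil kernels give local stalks and the unchanged topology, and localizations give `Spec
F(A)` on affine schemes. In the square, the comparison map from `X` to the fibre product is an étale
monomorphism that is surjective, hence an isomorphism. -/

noncomputable section

namespace Greenberg

/-! ### Étale algebras in characteristic `p` -/

section Frobenius

/-- An étale homomorphism with nil kernel is bijective if every element of the target has a
`p`-power in the image. -/
theorem bijective_algebraMap_of_etale {p : ℕ} [Fact p.Prime] {C D : Type u} [CommRing C]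
    [CommRing D] [Algebra C D] [Algebra.Etale C D] (hp : (p : C) = 0) (j : ℕ)
    (hD : ∀ d : D, d ^ p ^ j ∈ (algebraMap C D).range)
    (hker : RingHom.ker (algebraMap C D) ≤ nilradical C) :
    Function.Bijective (algebraMap C D) := by
  have hpos : 0 < p ^ j := pow_pos (Fact.out : p.Prime).pos j
  have hflat : Module.FaithfullyFlat C D := by
    -- Both hypotheses together make `Spec D → Spec C` a homeomorphism, so the flat map is
    -- faithfully flat.
    refine Module.FaithfullyFlat.of_comap_surjective ?_
    exact (PrimeSpectrum.isHomeomorph_comap _ (fun x => ⟨p ^ j, hpos, hD x⟩) hker).surjective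
  have hnil : ∀ s : D, IsNilpotent ((1 : D) ⊗ₜ[C] s - s ⊗ₜ[C] (1 : D)) := by
    intro s
    obtain ⟨c, hc⟩ := hD s
    -- The zero ring does not have characteristic `p`, so it is treated apart.
    rcases subsingleton_or_nontrivial (D ⊗[C] D) with h | h
    · exact ⟨1, Subsingleton.elim _ _⟩
    have : CharP (D ⊗[C] D) p := by
      refine (CharP.charP_iff_prime_eq_zero Fact.out).2 ?_
      rw [← map_natCast (algebraMap C (D ⊗[C] D)), hp, map_zero]
    refine ⟨p ^ j, ?_⟩
    rw [sub_pow_char_pow, Algebra.TensorProduct.tmul_pow, Algebra.TensorProduct.tmul_pow, one_pow,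
      ← hc, Algebra.algebraMap_eq_smul_one, TensorProduct.tmul_smul (R := C),
      ← TensorProduct.smul_tmul', sub_self]
  -- Unramifiedness gives an element of `D ⊗ D` that kills the diagonal ideal and is `1` modulo it.
  -- The diagonal ideal is nil, so this element is a unit and the diagonal ideal vanishes: `C → D`
  -- is an epimorphism.
  have hunit : IsUnit (Algebra.FormallyUnramified.elem C D) := by
    have h1 : (1 : D ⊗[C] D) - Algebra.FormallyUnramified.elem C D ∈
        KaehlerDifferential.ideal C D := by
      rw [KaehlerDifferential.ideal, RingHom.mem_ker, map_sub, map_one]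
      exact sub_eq_zero.2 (Algebra.FormallyUnramified.lmul_elem (R := C) (S := D)).symm
    have h2 : KaehlerDifferential.ideal C D ≤ nilradical (D ⊗[C] D) := by
      rw [← KaehlerDifferential.span_range_eq_ideal, Ideal.span_le]
      rintro _ ⟨s, rfl⟩
      exact hnil s
    have := IsNilpotent.isUnit_one_sub (h2 h1)
    rwa [sub_sub_cancel] at this
  have hepi : ∀ s : D, (1 : D) ⊗ₜ[C] s = s ⊗ₜ[C] (1 : D) := fun s =>
    hunit.mul_right_cancel (Algebra.FormallyUnramified.one_tmul_mul_elem s)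
  -- By faithfully flat descent it suffices that `D → D ⊗ D` is bijective; its inverse is the
  -- multiplication.
  refine Module.FaithfullyFlat.bijective_of_tensorProduct (S := D) ⟨?_, ?_⟩
  · refine Function.LeftInverse.injective (g := Algebra.TensorProduct.lmul' C (S := D)) fun d => ?_
    simp
  · intro x
    refine ⟨Algebra.TensorProduct.lmul' C x, ?_⟩
    change Algebra.TensorProduct.lmul' C x ⊗ₜ 1 = x
    induction x using TensorProduct.induction_on with
    | zero => rw [map_zero, TensorProduct.zero_tmul]
    | add x y hx hy => rw [map_add, TensorProduct.add_tmul, hx, hy]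
    | tmul a b =>
      calc (a * b) ⊗ₜ[C] (1 : D) = a ⊗ₜ[C] (1 : D) * b ⊗ₜ[C] (1 : D) := by simp
        _ = a ⊗ₜ[C] (1 : D) * (1 : D) ⊗ₜ[C] b := by rw [hepi b]
        _ = a ⊗ₜ[C] b := by simp

/-- The `p ^ j`-th power homomorphism of a ring in which `p = 0`. -/
def charPowHom {p : ℕ} [Fact p.Prime] {A : Type u} [CommRing A] (hp : (p : A) = 0) (j : ℕ) :
    A →+* A where
  toFun x := x ^ p ^ j
  map_one' := one_pow _
  map_mul' x y := mul_pow x y _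
  map_zero' := zero_pow (pow_pos (Fact.out : p.Prime).pos j).ne'
  map_add' x y := by
    rcases subsingleton_or_nontrivial A with h | h
    · exact Subsingleton.elim _ _
    have : CharP A p := (CharP.charP_iff_prime_eq_zero Fact.out).2 hp
    exact add_pow_char_pow x y p j

/-- A copy of the ring `A`, as an algebra over `A` through the `p ^ j`-th power homomorphism. -/
@[nolint unusedArguments]
def PowTwist {p : ℕ} [Fact p.Prime] {A : Type u} [CommRing A] (_ : (p : A) = 0) (_ : ℕ) :
    Type u := A

variable {p : ℕ} [Fact p.Prime] {A : Type u} [CommRing A] (hp : (p : A) = 0) (j : ℕ)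

instance : CommRing (PowTwist hp j) := inferInstanceAs (CommRing A)

/-- The identity of `A`, as an isomorphism to its twist. -/
def PowTwist.mk : A ≃+* PowTwist hp j := RingEquiv.refl A

instance : Algebra A (PowTwist hp j) :=
  ((PowTwist.mk hp j).toRingHom.comp (charPowHom hp j)).toAlgebra

theorem PowTwist.algebraMap_apply (a : A) :
    algebraMap A (PowTwist hp j) a = PowTwist.mk hp j (a ^ p ^ j) := rfl

variable {B : Type u} [CommRing B] [Algebra A B] (hp' : (p : B) = 0)

instance : Algebra (PowTwist hp j) (PowTwist hp' j) :=
  ((PowTwist.mk hp' j).toRingHom.comp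
    ((algebraMap A B).comp (PowTwist.mk hp j).symm.toRingHom)).toAlgebra

instance : Algebra A (PowTwist hp' j) :=
  ((algebraMap B (PowTwist hp' j)).comp (algebraMap A B)).toAlgebra

instance : IsScalarTower A B (PowTwist hp' j) := IsScalarTower.of_algebraMap_eq fun _ => rfl

/-- Powers commute with `A → B`, so passing through `B` or through the twist of `A` gives the same
structure. -/
instance : IsScalarTower A (PowTwist hp j) (PowTwist hp' j) :=
  IsScalarTower.of_algebraMap_eq fun a =>
    congrArg (PowTwist.mk hp' j) (map_pow (algebraMap A B) a (p ^ j)).symm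

instance [Algebra.Etale A B] : Algebra.Etale (PowTwist hp j) (PowTwist hp' j) :=
  have h : (algebraMap A B).Etale := RingHom.etale_algebraMap.2 inferInstance
  h

/-- The relative Frobenius homomorphism `A' ⊗ B → B'`, `a ⊗ b ↦ a * b ^ (p ^ j)`. -/
def relFrobenius : PowTwist hp j ⊗[A] B →ₐ[PowTwist hp j] PowTwist hp' j :=
  Algebra.TensorProduct.lift (Algebra.ofId _ _) (IsScalarTower.toAlgHom A B (PowTwist hp' j))
    fun _ _ => Commute.all _ _

theorem relFrobenius_tmul (a : A) (b : B) :
    relFrobenius hp j hp' (PowTwist.mk hp j a ⊗ₜ b) =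
      PowTwist.mk hp' j (algebraMap A B a * b ^ p ^ j) := rfl

/-- Source and target are étale over the twist of `A`, so the map between them is étale. On each
side the `p ^ j`-th power factors through the other: `d ^ p ^ j` is the image of `1 ⊗ d`, and `x ^ p
^ j` is `1 ⊗` the image of `x`. Hence `bijective_algebraMap_of_etale` applies. -/
theorem bijective_relFrobenius [Algebra.Etale A B] :
    Function.Bijective (relFrobenius hp j hp') := by
  let : Algebra (PowTwist hp j ⊗[A] B) (PowTwist hp' j) :=
    (relFrobenius hp j hp').toRingHom.toAlgebra
  have : IsScalarTower (PowTwist hp j) (PowTwist hp j ⊗[A] B) (PowTwist hp' j) :=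
    IsScalarTower.of_algebraMap_eq fun x => ((relFrobenius hp j hp').commutes x).symm
  have : Algebra.Etale (PowTwist hp j ⊗[A] B) (PowTwist hp' j) :=
    Algebra.Etale.of_restrictScalars (PowTwist hp j) _ _
  have h0 : ((p : ℕ) : PowTwist hp j ⊗[A] B) = 0 := by
    rw [← map_natCast (algebraMap A _), hp, map_zero]
  refine bijective_algebraMap_of_etale (p := p) h0 j ?_ ?_
  · intro d
    refine ⟨PowTwist.mk hp j 1 ⊗ₜ (PowTwist.mk hp' j).symm d, ?_⟩
    change relFrobenius hp j hp' _ = _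
    rw [relFrobenius_tmul, map_one, one_mul]
    rfl
  · have key : ∀ x : PowTwist hp j ⊗[A] B, x ^ p ^ j =
        Algebra.TensorProduct.includeRight
          ((PowTwist.mk hp' j).symm (relFrobenius hp j hp' x)) := by
      intro x
      change charPowHom h0 j x = _
      induction x using TensorProduct.induction_on with
      | zero => rw [map_zero, map_zero, map_zero, map_zero]
      | add x y hx hy => rw [map_add, map_add, map_add, map_add, hx, hy]
      | tmul a b =>
        change (a ⊗ₜ b) ^ p ^ j =
          (1 : PowTwist hp j) ⊗ₜ[A] (algebraMap A B ((PowTwist.mk hp j).symm a) * b ^ p ^ j)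
        rw [Algebra.TensorProduct.tmul_pow, ← Algebra.smul_def, TensorProduct.tmul_smul,
          TensorProduct.smul_tmul', Algebra.smul_def, PowTwist.algebraMap_apply, mul_one]
        rfl
    intro x hx
    refine ⟨p ^ j, ?_⟩
    rw [key, show relFrobenius hp j hp' x = 0 from hx, map_zero, map_zero]
    rfl

include hp in
/-- The relative Frobenius homomorphism of an étale algebra is bijective: the additive group of
`B` has the universal property of `A ⊗ B`, where `A` acts on itself through `p ^ j`-th powers. -/
theorem exists_addMonoidHom_of_balanced [Algebra.Etale A B] {M : Type*} [AddCommGroup M]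
    (g : A →+ B →+ M) (hg : ∀ c a b, g (c ^ p ^ j * a) b = g a (algebraMap A B c * b)) :
    ∃ G : B →+ M, ∀ a b, G (algebraMap A B a * b ^ p ^ j) = g a b := by
  have hp' : (p : B) = 0 := by rw [← map_natCast (algebraMap A B), hp, map_zero]
  let e := (AlgEquiv.ofBijective (relFrobenius hp j hp') (bijective_relFrobenius hp j hp'))
  let g' : PowTwist hp j →+ B →+ M := g.comp (PowTwist.mk hp j).symm.toAddMonoidHom
  let G' : PowTwist hp j ⊗[A] B →+ M := TensorProduct.liftAddHom g' fun c a b => by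
    exact (hg c ((PowTwist.mk hp j).symm a) b).trans (by rw [Algebra.smul_def]; rfl)
  refine ⟨G'.comp ((e.symm.toAddEquiv.toAddMonoidHom).comp
    (PowTwist.mk hp' j).toAddMonoidHom), fun a b => ?_⟩
  change G' (e.symm (PowTwist.mk hp' j _)) = _
  rw [← relFrobenius_tmul hp j hp']
  have : e.symm (relFrobenius hp j hp' (PowTwist.mk hp j a ⊗ₜ b)) = PowTwist.mk hp j a ⊗ₜ b :=
    e.symm_apply_apply (PowTwist.mk hp j a ⊗ₜ b)
  rw [this]
  rfl

include hp in
-- The surjective half of the relative Frobenius isomorphism, in the form needed for successive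
-- approximation.
theorem closure_mul_pow_eq_top [Algebra.Etale A B] :
    AddSubgroup.closure {x : B | ∃ a b, x = algebraMap A B a * b ^ p ^ j} = ⊤ := by
  have hp' : (p : B) = 0 := by rw [← map_natCast (algebraMap A B), hp, map_zero]
  refine top_unique fun x _ => ?_
  obtain ⟨t, ht⟩ := (bijective_relFrobenius hp j hp').2 (PowTwist.mk hp' j x)
  have : x = (PowTwist.mk hp' j).symm (relFrobenius hp j hp' t) := by rw [ht]; rfl
  rw [this]
  clear ht this
  induction t using TensorProduct.induction_on with
  | zero => rw [map_zero, map_zero]; exact zero_mem _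
  | add x y hx hy => rw [map_add, map_add]; exact add_mem hx hy
  | tmul a b => exact AddSubgroup.subset_closure ⟨(PowTwist.mk hp j).symm a, b, rfl⟩

end Frobenius

/-! ### Étale algebras lift along surjections with nil kernel -/

section Lift

/-- An étale algebra `B` over the quotient `A` of `S` by a nil ideal lifts to an étale algebra
over `S`. -/
theorem exists_etale_lift {S A B : Type u} [CommRing S] [CommRing A] [CommRing B] [Algebra S A]
    [Algebra A B] [Algebra S B] [IsScalarTower S A B] [Algebra.Etale A B]
    (hs : Function.Surjective (algebraMap S A))
    (hn : RingHom.ker (algebraMap S A) ≤ nilradical S) :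
    ∃ (C : Type u) (_ : CommRing C) (_ : Algebra S C) (_ : Algebra.Etale S C) (π : C →ₐ[S] B),
      Function.Surjective π ∧
        RingHom.ker π = (RingHom.ker (algebraMap S A)).map (algebraMap S C) := by
  classical
  obtain ⟨ι, σ, _, _, P, hP⟩ :=
    ((Algebra.Etale.iff_isStandardSmoothOfRelativeDimension_zero (R := A) (S := B)).1
      inferInstance).out
  cases nonempty_fintype σ
  -- The relations of a presentation of `B` with as many relations as variables are lifted
  -- coefficientwise to `S`; the lifted algebra is the quotient by these lifts.
  have : P.toPresentation.HasCoeffs S := ⟨fun x _ => hs x⟩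
  let v := P.relationOfHasCoeffs S
  let Q := P.toPreSubmersivePresentation.ofHasCoeffs S
  let π : P.ModelOfHasCoeffs S →ₐ[S] B :=
    Ideal.Quotient.liftₐ _ (MvPolynomial.aeval P.val) (by
      simp_rw [← RingHom.mem_ker, ← SetLike.le_def, Ideal.span_le]
      rintro _ ⟨i, rfl⟩
      simp)
  have hπ : ∀ q : MvPolynomial ι S, π (Ideal.Quotient.mk _ q) = MvPolynomial.aeval P.val q :=
    fun q => rfl
  have hsurj : Function.Surjective π := by
    intro b
    obtain ⟨q, hq⟩ := MvPolynomial.map_surjective (σ := ι) _ hs (P.σ b)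
    refine ⟨Ideal.Quotient.mk _ q, ?_⟩
    rw [hπ, ← MvPolynomial.aeval_map_algebraMap A, hq, P.aeval_val_σ]
  have hker : RingHom.ker π =
      (RingHom.ker (algebraMap S A)).map (algebraMap S (P.ModelOfHasCoeffs S)) := by
    apply le_antisymm
    · intro x hx
      obtain ⟨q, rfl⟩ := Ideal.Quotient.mk_surjective x
      have h1 : MvPolynomial.map (algebraMap S A) q ∈ P.ker := by
        rw [RingHom.mem_ker, hπ, ← MvPolynomial.aeval_map_algebraMap A] at hx
        rw [P.ker_eq_ker_aeval_val]
        exact hx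
      rw [← P.span_range_relation_eq_ker, Ideal.mem_span_range_iff_exists_fun] at h1
      obtain ⟨c, hc⟩ := h1
      choose c' hc' using fun i => MvPolynomial.map_surjective (σ := ι) _ hs (c i)
      -- Subtracting a combination of the lifted relations leaves a polynomial all of whose
      -- coefficients die in `A`.
      have h2 : q - ∑ i, c' i * v i ∈ (RingHom.ker (algebraMap S A)).map MvPolynomial.C := by
        rw [← MvPolynomial.ker_map, RingHom.mem_ker, map_sub, map_sum, ← hc, sub_eq_zero]
        refine Finset.sum_congr rfl fun i _ => ?_
        rw [map_mul, hc', P.map_relationOfHasCoeffs]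
      have h3 := Ideal.mem_map_of_mem (Ideal.Quotient.mk (Ideal.span (Set.range v))) h2
      rw [Ideal.map_map, map_sub, map_sum] at h3
      have h4 : ∑ i, Ideal.Quotient.mk (Ideal.span (Set.range v)) (c' i * v i) = 0 := by
        refine Finset.sum_eq_zero fun i _ => ?_
        exact Ideal.Quotient.eq_zero_iff_mem.2
          (Ideal.mul_mem_left _ _ (Ideal.subset_span ⟨i, rfl⟩))
      rw [h4, sub_zero] at h3
      exact h3
    · rw [Ideal.map_le_iff_le_comap]
      intro s hs'
      rw [Ideal.mem_comap, RingHom.mem_ker, AlgHom.commutes, IsScalarTower.algebraMap_apply S A B,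
        (RingHom.mem_ker).1 hs', map_zero]
  have hnil : RingHom.ker π ≤ nilradical (P.ModelOfHasCoeffs S) := by
    rw [hker, Ideal.map_le_iff_le_comap]
    exact fun s hs' => IsNilpotent.map (hn hs') _
  -- The lifted Jacobian reduces to the Jacobian of `P`, a unit of `B`, and units lift along
  -- surjections with nil kernel.
  have hjac : IsUnit Q.jacobian := by
    have h1 : π Q.jacobian = P.jacobian := by
      have h2 : Q.jacobian = Ideal.Quotient.mk _ Q.jacobiMatrix.det :=
        Q.jacobian_eq_jacobiMatrix_det
      rw [h2, hπ, ← MvPolynomial.aeval_map_algebraMap A, P.jacobian_eq_jacobiMatrix_det]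
      have h3 : MvPolynomial.map (algebraMap S A) Q.jacobiMatrix.det = P.jacobiMatrix.det := by
        rw [RingHom.map_det]
        congr 1
        ext1 i j
        simp [Q, Algebra.Presentation.map_relationOfHasCoeffs, ← MvPolynomial.pderiv_map,
          Algebra.PreSubmersivePresentation.jacobiMatrix_apply]
      rw [h3, Algebra.Generators.algebraMap_apply]
    obtain ⟨b, hb⟩ := P.jacobian_isUnit.exists_right_inv
    obtain ⟨c, rfl⟩ := hsurj b
    have h2 : Q.jacobian * c - 1 ∈ RingHom.ker π := by
      rw [RingHom.mem_ker, map_sub, map_mul, h1, hb, map_one, sub_self]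
    have h3 : IsUnit (Q.jacobian * c) := by
      have := IsNilpotent.isUnit_add_one (hnil h2)
      rwa [sub_add_cancel] at this
    exact isUnit_of_mul_isUnit_left h3
  refine ⟨P.ModelOfHasCoeffs S, inferInstance, inferInstance, ?_, π, hsurj, hker⟩
  rw [Algebra.Etale.iff_isStandardSmoothOfRelativeDimension_zero]
  exact ⟨_, _, inferInstance, inferInstance, ⟨Q, hjac⟩, hP⟩

end Lift

/-! ### A complete discrete valuation ring as a module over `W(k)` -/

section Basis

variable (p : ℕ) [Fact p.Prime] (R : Type u) [CommRing R] [IsDomain R]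
  [IsDiscreteValuationRing R] [CharP (IsLocalRing.ResidueField R) p]

theorem exists_uniformizer_pow_associated [CharZero R] :
    ∃ (ϖ : R) (e : ℕ), Irreducible ϖ ∧ 0 < e ∧ Associated (p : R) (ϖ ^ e) := by
  obtain ⟨ϖ, hϖ⟩ := IsDiscreteValuationRing.exists_irreducible R
  have hp0 : (p : R) ≠ 0 := Nat.cast_ne_zero.2 (Fact.out : p.Prime).ne_zero
  obtain ⟨e, he⟩ := IsDiscreteValuationRing.associated_pow_irreducible hp0 hϖ
  refine ⟨ϖ, e, hϖ, Nat.pos_of_ne_zero ?_, he⟩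
  rintro rfl
  have h1 := natCast_mem_maximalIdeal p R
  rw [pow_zero, associated_one_iff_isUnit] at he
  exact (IsLocalRing.mem_maximalIdeal _).1 h1 he

variable {R}

theorem mem_maximalIdeal_pow_iff {ϖ : R} (hϖ : Irreducible ϖ) (m : ℕ) (x : R) :
    x ∈ IsLocalRing.maximalIdeal R ^ m ↔ ϖ ^ m ∣ x := by
  rw [hϖ.maximalIdeal_eq, Ideal.span_singleton_pow, Ideal.mem_span_singleton]

/-- Over a perfect ring, vanishing of the first `t` components means divisibility by `p ^ t`. As `p
= VF`, the division extracts a `p ^ t`-th root of the leading component. -/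
theorem exists_eq_mul_p_pow {k : Type u} [CommRing k] [CharP k p] [PerfectRing k p]
    (x : WittVector p k) (t : ℕ) (h : ∀ s < t, x.coeff s = 0) :
    ∃ y : WittVector p k, x = y * (p : WittVector p k) ^ t ∧ x.coeff t = y.coeff 0 ^ p ^ t := by
  have h1 := (WittVector.mem_span_p_pow_iff_le_coeff_eq_zero x t).2 h
  obtain ⟨y, hy⟩ := Ideal.mem_span_singleton.1 h1
  refine ⟨y, hy.trans (mul_comm _ _), ?_⟩
  rw [hy, mul_comm]
  simpa using WittVector.mul_pow_charP_coeff_succ y (m := 0) (n := t)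

variable [PerfectRing (IsLocalRing.ResidueField R) p]
  [IsAdicComplete (IsLocalRing.maximalIdeal R) R]
  {ϖ : R} {e : ℕ} (hϖ : Irreducible ϖ) (he : 0 < e) (hp : Associated (p : R) (ϖ ^ e))

include hp in
theorem pow_dvd_wittLift_mul (x : WittVector p (IsLocalRing.ResidueField R)) (i m : ℕ)
    (h : ∀ t, i + t * e < m → x.coeff t = 0) : ϖ ^ m ∣ wittLift p R x * ϖ ^ i := by
  by_cases hm : ∃ t, m ≤ i + t * e
  · classical
    have h1 := Nat.find_spec hm
    obtain ⟨y, hy, -⟩ := exists_eq_mul_p_pow p x (Nat.find hm) fun s hs =>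
      h s (not_le.1 (Nat.find_min hm hs))
    refine (pow_dvd_pow ϖ h1).trans ?_
    rw [hy, map_mul, map_pow, map_natCast, pow_add, mul_comm (ϖ ^ i), mul_comm (Nat.find hm),
      pow_mul]
    exact mul_dvd_mul_right ((pow_dvd_pow_of_dvd hp.dvd' _).trans (Dvd.intro_left _ rfl)) _
  · push Not at hm
    have : x = 0 := by
      ext t
      rw [h t (hm t), WittVector.zero_coeff]
    rw [this, map_zero, zero_mul]
    exact dvd_zero _

include hϖ in
theorem coeff_zero_eq_zero_of_dvd (x : WittVector p (IsLocalRing.ResidueField R))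
    (h : ϖ ∣ wittLift p R x) : x.coeff 0 = 0 := by
  rw [← residue_wittLift, IsLocalRing.residue_eq_zero_iff, hϖ.maximalIdeal_eq]
  exact Ideal.mem_span_singleton.2 h

include hϖ he hp in
-- The valuations `i + t * e` with `i < e` are pairwise distinct, so no cancellation can occur. In
-- the induction at most one pair `(i, t)` has valuation exactly `m`. All other summands are
-- divisible by `ϖ ^ (m + 1)`, which forces the leading component of the remaining one to vanish.
theorem coeff_eq_zero_of_pow_dvd_sum (x : Fin e → WittVector p (IsLocalRing.ResidueField R))
    (m : ℕ) (h : ϖ ^ m ∣ ∑ i, wittLift p R (x i) * ϖ ^ (i : ℕ)) (i : Fin e) (t : ℕ)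
    (hit : i + t * e < m) : (x i).coeff t = 0 := by
  induction m generalizing i t with
  | zero => omega
  | succ m ih =>
    have ih' := fun i t => ih ((pow_dvd_pow ϖ m.le_succ).trans h) i t
    rcases Nat.lt_succ_iff_lt_or_eq.1 hit with h1 | h1
    · exact ih' i t h1
    have hmod : ∀ i' : Fin e, i' ≠ i → ∀ t', i' + t' * e ≠ m := by
      intro i' hi' t' h2
      refine hi' (Fin.ext ?_)
      rw [← h1] at h2
      have h3 := congrArg (· % e) h2
      simpa [Nat.add_mul_mod_self_right, Nat.mod_eq_of_lt] using h3
    have hothers : ϖ ^ (m + 1) ∣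
        ∑ i' ∈ Finset.univ.erase i, wittLift p R (x i') * ϖ ^ (i' : ℕ) := by
      refine Finset.dvd_sum fun i' hi' => pow_dvd_wittLift_mul p hp _ _ _ fun t' ht' => ih' i' t' ?_
      have := hmod i' (Finset.ne_of_mem_erase hi') t'
      omega
    rw [← Finset.add_sum_erase _ _ (Finset.mem_univ i), dvd_add_left hothers] at h
    obtain ⟨y, hy, hy'⟩ := exists_eq_mul_p_pow p (x i) t fun s hs => ih' i s (by
      rw [← h1]
      have := Nat.mul_lt_mul_of_pos_right hs he
      omega)
    obtain ⟨u, hu⟩ := hp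
    have h2 : ϖ ^ m * ϖ ∣ ϖ ^ m * (wittLift p R y * ↑(u⁻¹ ^ t)) := by
      have h3 : (p : R) = ϖ ^ e * ↑u⁻¹ := by rw [← hu, mul_assoc, Units.mul_inv, mul_one]
      rw [hy, map_mul, map_pow, map_natCast, h3, mul_pow, ← pow_mul, pow_succ] at h
      convert h using 1
      rw [← h1, pow_add, mul_comm t e, Units.val_pow_eq_pow_val]
      ring
    have h4 := (mul_dvd_mul_iff_left (pow_ne_zero m hϖ.ne_zero)).1 h2
    rw [hy', coeff_zero_eq_zero_of_dvd p hϖ y ((Units.dvd_mul_right).1 h4),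
      zero_pow (pow_pos (Fact.out : p.Prime).pos t).ne']

theorem mem_span_p_pow_smul_top {W M : Type*} [CommRing W] [AddCommGroup M] [Module W M] (a : W)
    (n : ℕ) (x : M) :
    x ∈ (Ideal.span {a} ^ n • ⊤ : Submodule W M) ↔ ∃ y, a ^ n • y = x := by
  rw [Ideal.span_singleton_pow, Submodule.ideal_span_singleton_smul,
    Submodule.mem_smul_pointwise_iff_exists]
  simp

theorem isPrecomplete_pi {W ι : Type*} [CommRing W] (a : W) [IsPrecomplete (Ideal.span {a}) W] :
    IsPrecomplete (Ideal.span {a}) (ι → W) := by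
  refine ⟨fun f hf => ?_⟩
  have h1 : ∀ i, ∃ L : W, ∀ n, f n i ≡ L [SMOD (Ideal.span {a} ^ n • ⊤ : Submodule W W)] := by
    intro i
    refine IsPrecomplete.prec ‹_› fun {m n} hmn => ?_
    have := hf hmn
    rw [SModEq.sub_mem, mem_span_p_pow_smul_top] at this ⊢
    obtain ⟨y, hy⟩ := this
    exact ⟨y i, congrFun hy i⟩
  choose L hL using h1
  refine ⟨L, fun n => ?_⟩
  simp only [SModEq.sub_mem, mem_span_p_pow_smul_top] at hL ⊢
  choose y hy using fun i => hL i n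
  exact ⟨y, funext hy⟩

include hϖ in
-- Expansion in powers of `ϖ`, whose digits are Teichmüller representatives of residues.
theorem exists_pow_dvd_sub_sum (y : R) (l : ℕ) :
    ∃ x : ℕ → WittVector p (IsLocalRing.ResidueField R),
      ϖ ^ l ∣ y - ∑ i ∈ Finset.range l, wittLift p R (x i) * ϖ ^ i := by
  induction l with
  | zero => exact ⟨0, by simp⟩
  | succ l ih =>
    obtain ⟨x, z, hz⟩ := ih
    let c := WittVector.teichmuller p (IsLocalRing.residue R z)
    have hc : ϖ ∣ z - wittLift p R c := by
      rw [← Ideal.mem_span_singleton, ← hϖ.maximalIdeal_eq, ← IsLocalRing.residue_eq_zero_iff,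
        map_sub, residue_wittLift, WittVector.teichmuller_coeff_zero, sub_self]
    refine ⟨Function.update x l c, ?_⟩
    have hs : ∑ i ∈ Finset.range l, wittLift p R (Function.update x l c i) * ϖ ^ i =
        ∑ i ∈ Finset.range l, wittLift p R (x i) * ϖ ^ i := by
      refine Finset.sum_congr rfl fun i hi => ?_
      rw [Function.update_of_ne (Finset.mem_range.1 hi).ne]
    rw [Finset.sum_range_succ, hs, Function.update_self, ← sub_sub, hz, pow_succ, mul_comm _ (ϖ ^ l),
      ← mul_sub]
    exact mul_dvd_mul_left _ hc

variable (R) in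
include hϖ he hp in
-- Independence is the absence of cancellation, applied to divisibility of `0` by every power of
-- `ϖ`. For generation, `e` digits suffice modulo `p`; completeness of `W(k)` and separatedness of
-- `R` for the `p`-adic topology then lift surjectivity from the quotient by `p`.
theorem exists_basis :
    letI := wittAlgebra p R
    ∃ b : Module.Basis (Fin e) (WittVector p (IsLocalRing.ResidueField R)) R,
      ∀ i, b i = ϖ ^ (i : ℕ) := by
  let := wittAlgebra p R
  let f : (Fin e → WittVector p (IsLocalRing.ResidueField R)) →ₗ[
      WittVector p (IsLocalRing.ResidueField R)] R :=
    Fintype.linearCombination _ fun i : Fin e => ϖ ^ (i : ℕ)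
  have hf : ∀ x, f x = ∑ i, wittLift p R (x i) * ϖ ^ (i : ℕ) := fun x => rfl
  have hinj : Function.Injective f := by
    rw [injective_iff_map_eq_zero]
    intro x hx
    funext i
    ext t
    refine (coeff_eq_zero_of_pow_dvd_sum p hϖ he hp x (i + t * e + 1) ?_ i t
      (Nat.lt_succ_self _)).trans (WittVector.zero_coeff _ _ _).symm
    rw [← hf, hx]
    exact dvd_zero _
  have hpre : IsPrecomplete (Ideal.span {(p : WittVector p (IsLocalRing.ResidueField R))})
      (Fin e → WittVector p (IsLocalRing.ResidueField R)) := isPrecomplete_pi _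
  have hmem : ∀ n (x : R), x ∈ (Ideal.span {(p : WittVector p (IsLocalRing.ResidueField R))} ^ n •
      ⊤ : Submodule (WittVector p (IsLocalRing.ResidueField R)) R) ↔ (p : R) ^ n ∣ x := by
    intro n x
    rw [mem_span_p_pow_smul_top]
    refine exists_congr fun y => ?_
    rw [Algebra.smul_def, map_pow, map_natCast, eq_comm]
  have hhaus : IsHausdorff (Ideal.span {(p : WittVector p (IsLocalRing.ResidueField R))}) R := by
    refine ⟨fun x hx => IsHausdorff.haus (I := IsLocalRing.maximalIdeal R) inferInstance x
      fun n => ?_⟩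
    have h1 := hx n
    rw [SModEq.zero, hmem] at h1
    rw [SModEq.zero, smul_eq_mul, Ideal.mul_top]
    exact Ideal.mem_of_dvd _ h1 (Ideal.pow_mem_pow (natCast_mem_maximalIdeal p R) n)
  have hsurj : Function.Surjective f := by
    refine surjective_of_mkQ_comp_surjective
      (I := Ideal.span {(p : WittVector p (IsLocalRing.ResidueField R))}) fun y => ?_
    obtain ⟨y, rfl⟩ := Submodule.mkQ_surjective _ y
    obtain ⟨x, hx⟩ := exists_pow_dvd_sub_sum p hϖ y e
    refine ⟨fun i => x i, ((Submodule.Quotient.eq _).2 ?_).symm⟩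
    rw [← pow_one (Ideal.span _), hmem, pow_one, hf, Fin.sum_univ_eq_sum_range
      (fun i => wittLift p R (x i) * ϖ ^ i)]
    exact hp.dvd.trans hx
  refine ⟨Module.Basis.ofEquivFun (LinearEquiv.ofBijective f ⟨hinj, hsurj⟩).symm, fun i => ?_⟩
  rw [Module.Basis.coe_ofEquivFun]
  change f (Pi.single i 1) = _
  rw [hf, Finset.sum_eq_single i]
  · simp
  · intro j _ hj
    rw [Pi.single_eq_of_ne hj, map_zero, zero_mul]
  · simp

end Basis

/-! ### Coordinates on `𝓡(A)` -/

section Coordinates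

theorem natCast_eq_zero_of_ringHom {k A : Type*} [CommRing k] [CommRing A] (p : ℕ) [CharP k p]
    (s : k →+* A) : (p : A) = 0 := by
  rw [← map_natCast s, CharP.cast_eq_zero, map_zero]

theorem charP_of_ringHom {k A : Type*} [CommRing k] [CommRing A] [Nontrivial A] (p : ℕ)
    [Fact p.Prime] [CharP k p] (s : k →+* A) : CharP A p :=
  (CharP.charP_iff_prime_eq_zero Fact.out).2 (natCast_eq_zero_of_ringHom p s)

theorem subsingleton_wittVector (p : ℕ) (A : Type*) [Subsingleton A] :
    Subsingleton (WittVector p A) :=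
  ⟨fun _ _ => WittVector.ext fun _ => Subsingleton.elim _ _⟩

/-- A uniformizer `ϖ` together with the ramification index `e` of a discrete valuation ring of
mixed characteristic. -/
structure Ramification (p : ℕ) (R : Type u) [CommRing R] where
  /-- a uniformizer -/
  ϖ : R
  /-- the ramification index -/
  e : ℕ
  irreducible : Irreducible ϖ
  pos : 0 < e
  associated : Associated (p : R) (ϖ ^ e)

theorem exists_ramification (p : ℕ) [Fact p.Prime] (R : Type u) [CommRing R] [IsDomain R]
    [IsDiscreteValuationRing R] [CharP (IsLocalRing.ResidueField R) p] [CharZero R] :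
    Nonempty (Ramification p R) :=
  let ⟨ϖ, e, h1, h2, h3⟩ := exists_uniformizer_pow_associated p R
  ⟨⟨ϖ, e, h1, h2, h3⟩⟩

section

variable {p : ℕ} {R : Type u} [CommRing R] (D : Ramification p R)

namespace Ramification

/-- The number of `t` such that `i + t * e < m`. -/
def digits (m i : ℕ) : ℕ := (m - i + (D.e - 1)) / D.e

theorem lt_digits_iff (m i t : ℕ) : t < D.digits m i ↔ i + t * D.e < m := by
  have := D.pos
  rw [digits, Nat.lt_iff_add_one_le, Nat.le_div_iff_mul_le this, add_mul, one_mul]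
  omega

/-- Locates the `m`-th graded piece: its representatives are `V^(m / e)(a) ⊗ ϖ ^ (m % e)`. -/
theorem digits_self (m : ℕ) : D.digits m (m % D.e) = m / D.e := by
  apply le_antisymm
  · rw [← not_lt, D.lt_digits_iff, mul_comm, Nat.mod_add_div]
    exact lt_irrefl _
  · by_contra! h
    have h1 := (D.lt_digits_iff m (m % D.e) (D.digits m (m % D.e))).not.1 (lt_irrefl _)
    have h2 := Nat.mul_lt_mul_of_pos_right h D.pos
    have h3 := Nat.mod_add_div m D.e
    rw [mul_comm] at h3
    omega

theorem mem_pow_digits [IsDomain R] [IsDiscreteValuationRing R] (m i : ℕ) (r : R) :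
    (p : R) ^ D.digits m i * (D.ϖ ^ i * r) ∈ IsLocalRing.maximalIdeal R ^ m := by
  rw [mem_maximalIdeal_pow_iff D.irreducible, ← mul_assoc]
  refine Dvd.dvd.mul_right ?_ r
  have h1 : m ≤ D.digits m i * D.e + i := by
    have := (D.lt_digits_iff m i (D.digits m i)).not.1 (lt_irrefl _)
    omega
  refine (pow_dvd_pow _ h1).trans ?_
  rw [pow_add, mul_comm (D.digits m i), pow_mul]
  exact mul_dvd_mul_right (pow_dvd_pow_of_dvd D.associated.dvd' _) _

end Ramification

end

variable {p : ℕ} [Fact p.Prime] {R : Type u} [CommRing R] [IsDomain R]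
  [IsDiscreteValuationRing R] [CharP (IsLocalRing.ResidueField R) p]
  [PerfectRing (IsLocalRing.ResidueField R) p] [IsAdicComplete (IsLocalRing.maximalIdeal R) R]

variable {A : Type u} [CommRing A] (s : IsLocalRing.ResidueField R →+* A)

theorem WittExt.induction {P : WittExt p R s → Prop} (zero : P 0)
    (tmul : ∀ a r, P (WittExt.tmul p R s a r)) (add : ∀ x y, P x → P y → P (x + y))
    (x : WittExt p R s) : P x := by
  let := wittAlgebra p R
  let := wittMapAlgebra p s
  induction x using TensorProduct.induction_on with
  | zero => exact zero
  | tmul a r => exact tmul a r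
  | add x y hx hy => exact add x y hx hy

theorem WittExt.tmul_mul_tmul (a b : WittVector p A) (r t : R) :
    WittExt.tmul p R s a r * WittExt.tmul p R s b t = WittExt.tmul p R s (a * b) (r * t) := by
  simp only [← WittExt.inclW_mul_inclR, map_mul]
  ring

theorem WittExt.tmul_add (a : WittVector p A) (r t : R) :
    WittExt.tmul p R s a (r + t) = WittExt.tmul p R s a r + WittExt.tmul p R s a t := by
  simp only [← WittExt.inclW_mul_inclR, map_add]
  ring

theorem WittExt.tmul_wittLift_mul (a : WittVector p A)
    (c : WittVector p (IsLocalRing.ResidueField R)) (r : R) :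
    WittExt.tmul p R s a (wittLift p R c * r) =
      WittExt.tmul p R s (a * WittVector.map s c) r := by
  simp only [← WittExt.inclW_mul_inclR, map_mul]
  rw [mul_assoc, ← RingHom.comp_apply (WittExt.inclW p R s) (WittVector.map s),
    WittExt.inclW_comp]
  rfl

namespace Ramification

variable (D : Ramification p R)

/-- The basis `1, ϖ, …, ϖ ^ (e - 1)` of `R` over `W(k)`. -/
def basis :
    letI := wittAlgebra p R
    Module.Basis (Fin D.e) (WittVector p (IsLocalRing.ResidueField R)) R :=
  (exists_basis p R D.irreducible D.pos D.associated).choose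

theorem basis_apply (i : Fin D.e) :
    letI := wittAlgebra p R
    D.basis i = D.ϖ ^ (i : ℕ) :=
  (exists_basis p R D.irreducible D.pos D.associated).choose_spec i

/-- The coefficients of an element of `R` with respect to the basis `1, ϖ, …, ϖ ^ (e - 1)`. -/
def repr (r : R) (i : Fin D.e) : WittVector p (IsLocalRing.ResidueField R) :=
  letI := wittAlgebra p R
  D.basis.repr r i

theorem sum_repr (r : R) : ∑ i, wittLift p R (D.repr r i) * D.ϖ ^ (i : ℕ) = r := by
  let := wittAlgebra p R
  conv_rhs => rw [← D.basis.sum_repr r]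
  refine Finset.sum_congr rfl fun i _ => ?_
  rw [D.basis_apply, Algebra.smul_def]
  rfl

/-- The coefficient of `ϖ ^ i` of an element of `𝓡(A)`. -/
def comp (i : Fin D.e) : WittExt p R s →+ WittVector p A :=
  letI := wittAlgebra p R
  letI := wittMapAlgebra p s
  ((Finsupp.applyAddHom i).comp
    (Algebra.TensorProduct.basis (WittVector p A) D.basis).repr.toAddEquiv.toAddMonoidHom)

theorem comp_tmul (i : Fin D.e) (a : WittVector p A) (r : R) :
    D.comp s i (WittExt.tmul p R s a r) = a * WittVector.map s (D.repr r i) := by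
  let := wittAlgebra p R
  let := wittMapAlgebra p s
  change (Algebra.TensorProduct.basis (WittVector p A) D.basis).repr
    (a ⊗ₜ[WittVector p (IsLocalRing.ResidueField R)] r) i = _
  rw [Algebra.TensorProduct.basis_repr_tmul]
  rfl

theorem exists_comp_eq (f : Fin D.e → WittVector p A) :
    ∃ x : WittExt p R s, ∀ i, D.comp s i x = f i := by
  let := wittAlgebra p R
  let := wittMapAlgebra p s
  refine ⟨(Algebra.TensorProduct.basis (WittVector p A) D.basis).repr.symm
    (Finsupp.equivFunOnFinite.symm f), fun i => ?_⟩
  change (Algebra.TensorProduct.basis (WittVector p A) D.basis).repr _ i = _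
  rw [LinearEquiv.apply_symm_apply]
  rfl

theorem eq_sum_tmul_comp (x : WittExt p R s) :
    x = ∑ i, WittExt.tmul p R s (D.comp s i x) (D.ϖ ^ (i : ℕ)) := by
  let := wittAlgebra p R
  let := wittMapAlgebra p s
  conv_lhs => rw [← (Algebra.TensorProduct.basis (WittVector p A) D.basis).sum_repr x]
  refine Finset.sum_congr rfl fun i _ => ?_
  rw [Algebra.TensorProduct.basis_repr_symm_apply', D.basis_apply]
  rfl

variable {s} in
theorem comp_map {B : Type u} [CommRing B] {s' : IsLocalRing.ResidueField R →+* B} (t : A →+* B)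
    (ht : t.comp s = s') (i : Fin D.e) (x : WittExt p R s) :
    D.comp s' i (WittExt.map p R t ht x) = WittVector.map t (D.comp s i x) := by
  induction x using WittExt.induction with
  | zero => simp only [map_zero]
  | add x y hx hy => simp only [map_add, hx, hy]
  | tmul a r =>
    subst ht
    rw [WittExt.map_tmul, comp_tmul, comp_tmul, map_mul]
    rfl

/-- Multiplication by `p ^ j` shifts Witt components by `j` places and raises them to `p ^ j`-th
powers; the powers are harmless because the residue field is reduced. -/
theorem coeff_repr_eq_zero {r : R} {j m : ℕ}
    (h : (p : R) ^ j * r ∈ IsLocalRing.maximalIdeal R ^ m) (i : Fin D.e) (t : ℕ)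
    (ht : i + (t + j) * D.e < m) : (D.repr r i).coeff t = 0 := by
  rw [mem_maximalIdeal_pow_iff D.irreducible, ← D.sum_repr r, Finset.mul_sum] at h
  have h1 := coeff_eq_zero_of_pow_dvd_sum p D.irreducible D.pos D.associated
    (fun i => D.repr r i * (p : WittVector p (IsLocalRing.ResidueField R)) ^ j) m (by
      convert h using 2 with i
      simp only [map_mul, map_pow, map_natCast]
      ring) i (t + j) ht
  rw [WittVector.mul_pow_charP_coeff_succ] at h1
  exact eq_zero_of_pow_eq_zero h1

/-- The `i`-th component is `V^j(a) * r_i = V^j(a * F^j(r_i))`. The Verschiebung contributes `j`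
zeros and the coefficient `r_i` contributes the others. -/
theorem comp_generator_mem {j m : ℕ} (a : WittVector p A) {r : R}
    (h : (p : R) ^ j * r ∈ IsLocalRing.maximalIdeal R ^ m) (i : Fin D.e) :
    D.comp s i (WittExt.tmul p R s (WittVector.verschiebung^[j] a) r) ∈
      RingHom.ker (WittVector.truncate (p := p) (R := A) (D.digits m i)) := by
  rcases subsingleton_or_nontrivial A with hA | hA
  · have := subsingleton_wittVector p A
    rw [Subsingleton.elim (D.comp s i _) 0]
    exact zero_mem _
  have := charP_of_ringHom p s
  rw [WittVector.mem_ker_truncate]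
  intro t ht
  rw [comp_tmul, WittVector.iterate_verschiebung_mul_left]
  rcases lt_or_ge t j with htj | htj
  · exact WittVector.iterate_verschiebung_coeff_eq_zero _ htj
  obtain ⟨t, rfl⟩ := Nat.exists_eq_add_of_le' htj
  rw [WittVector.iterate_verschiebung_coeff]
  have h1 : WittVector.frobenius^[j] (WittVector.map s (D.repr r i)) ∈
      RingHom.ker (WittVector.truncate (p := p) (R := A) (t + 1)) := by
    rw [WittVector.mem_ker_truncate]
    intro t' ht'
    rw [WittVector.iterate_frobenius_coeff, WittVector.map_coeff,
      D.coeff_repr_eq_zero h i t', map_zero, zero_pow (pow_pos (Fact.out : p.Prime).pos j).ne']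
    have h2 := (D.lt_digits_iff _ _ _).1 ht
    have h3 : (t' + j) * D.e ≤ (t + j) * D.e := Nat.mul_le_mul_right _ (by omega)
    omega
  exact (WittVector.mem_ker_truncate _ _).1 (Ideal.mul_mem_left _ a h1) t (Nat.lt_succ_self t)

theorem exists_eq_iterate_verschiebung {N : ℕ} {x : WittVector p A}
    (h : x ∈ RingHom.ker (WittVector.truncate (p := p) (R := A) N)) :
    ∃ a, x = WittVector.verschiebung^[N] a ∧ x.coeff N = a.coeff 0 := by
  have := WittVector.eq_iterate_verschiebung ((WittVector.mem_ker_truncate _ _).1 h)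
  refine ⟨x.shift N, this, ?_⟩
  rw [WittVector.shift_coeff, add_zero]

/-- Makes the componentwise description an ideal: `b ⊗ r` times `V^N(a) ⊗ ϖ ^ l` is `V^N(a * F^N(b))
⊗ (r * ϖ ^ l)`, again a generator of the same level. -/
theorem comp_mul_mem {m : ℕ} {x : WittExt p R s}
    (hx : ∀ i : Fin D.e, D.comp s i x ∈
      RingHom.ker (WittVector.truncate (p := p) (R := A) (D.digits m i)))
    (y : WittExt p R s) (i : Fin D.e) : D.comp s i (y * x) ∈
      RingHom.ker (WittVector.truncate (p := p) (R := A) (D.digits m i)) := by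
  choose a ha _ using fun i => exists_eq_iterate_verschiebung (hx i)
  induction y using WittExt.induction with
  | zero => rw [zero_mul, map_zero]; exact zero_mem _
  | add y z hy hz => rw [add_mul, map_add]; exact add_mem hy hz
  | tmul b r =>
    rw [D.eq_sum_tmul_comp s x, Finset.mul_sum, map_sum]
    refine sum_mem fun l _ => ?_
    rw [WittExt.tmul_mul_tmul, ha, mul_comm, WittVector.iterate_verschiebung_mul_left, mul_comm r]
    exact D.comp_generator_mem s _ (D.mem_pow_digits m l r) i

theorem mem_wittFil_iff_truncate (m : ℕ) (x : WittExt p R s) :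
    x ∈ wittFil p R s m ↔ ∀ i : Fin D.e, D.comp s i x ∈
      RingHom.ker (WittVector.truncate (p := p) (R := A) (D.digits m i)) := by
  constructor
  · intro hx
    refine Submodule.span_induction (p := fun x _ => ∀ i : Fin D.e, D.comp s i x ∈
      RingHom.ker (WittVector.truncate (p := p) (R := A) (D.digits m i))) ?_ ?_ ?_ ?_ hx
    · rintro _ ⟨j, a, r, hr, rfl⟩ i
      exact D.comp_generator_mem s a hr i
    · intro i
      rw [map_zero]
      exact zero_mem _
    · intro x y _ _ hx hy i
      rw [map_add]
      exact add_mem (hx i) (hy i)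
    · intro y x _ hx i
      exact D.comp_mul_mem s hx y i
  · intro hx
    choose a ha _ using fun i => exists_eq_iterate_verschiebung (hx i)
    rw [D.eq_sum_tmul_comp s x]
    refine sum_mem fun i _ => Ideal.subset_span ⟨D.digits m i, a i, D.ϖ ^ (i : ℕ), ?_, ?_⟩
    · simpa using D.mem_pow_digits m i 1
    · rw [ha]

/-- The `l`-th coordinate of an element of `𝓡(A)`: the coefficient of `p ^ t * ϖ ^ i`, where
`l = i + t * e`. -/
def coord (l : ℕ) (x : WittExt p R s) : A :=
  (D.comp s ⟨l % D.e, Nat.mod_lt _ D.pos⟩ x).coeff (l / D.e)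

/-- Division with remainder, `l = i + t * e`, passes between single coordinates and Witt components.
-/
theorem forall_coord_iff {P : ℕ → A → A → Prop} (x y : WittExt p R s) :
    (∀ l, P l (D.coord s l x) (D.coord s l y)) ↔ ∀ (i : Fin D.e) t,
      P (i + t * D.e) ((D.comp s i x).coeff t) ((D.comp s i y).coeff t) := by
  constructor
  · intro h i t
    have := h (i + t * D.e)
    have h1 : (⟨(i + t * D.e) % D.e, Nat.mod_lt _ D.pos⟩ : Fin D.e) = i :=
      Fin.ext ((Nat.add_mul_mod_self_right _ _ _).trans (Nat.mod_eq_of_lt i.2))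
    have h2 : (i + t * D.e) / D.e = t := by
      rw [Nat.add_mul_div_right _ _ D.pos, Nat.div_eq_of_lt i.2, zero_add]
    rwa [coord, coord, h1, h2] at this
  · intro h l
    have := h ⟨l % D.e, Nat.mod_lt _ D.pos⟩ (l / D.e)
    rwa [mul_comm, Nat.mod_add_div] at this

theorem sub_mem_wittFil_iff (m : ℕ) (x y : WittExt p R s) :
    x - y ∈ wittFil p R s m ↔ ∀ l < m, D.coord s l x = D.coord s l y := by
  rw [D.forall_coord_iff s (P := fun l a b => l < m → a = b), D.mem_wittFil_iff_truncate]
  refine forall_congr' fun i => ?_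
  rw [WittVector.mem_ker_truncate, map_sub,
    ← WittVector.le_coeff_eq_iff_le_sub_coeff_eq_zero]
  exact forall_congr' fun t => imp_congr_left (D.lt_digits_iff m i t)

theorem coord_zero_right (l : ℕ) : D.coord s l 0 = 0 := by
  rw [coord, map_zero, WittVector.zero_coeff]

theorem mem_wittFil_iff (m : ℕ) (x : WittExt p R s) :
    x ∈ wittFil p R s m ↔ ∀ l < m, D.coord s l x = 0 := by
  have := D.sub_mem_wittFil_iff s m x 0
  simpa only [sub_zero, coord_zero_right] using this

theorem exists_coord_eq (f : ℕ → A) : ∃ x : WittExt p R s, ∀ l, D.coord s l x = f l := by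
  obtain ⟨x, hx⟩ := D.exists_comp_eq s fun i => WittVector.mk p fun t => f (i + t * D.e)
  refine ⟨x, (D.forall_coord_iff s (P := fun l a _ => a = f l) x x).2 fun i t => ?_⟩
  rw [hx, WittVector.coeff_mk]

variable {s} in
theorem coord_map {B : Type u} [CommRing B] {s' : IsLocalRing.ResidueField R →+* B} (t : A →+* B)
    (ht : t.comp s = s') (l : ℕ) (x : WittExt p R s) :
    D.coord s' l (WittExt.map p R t ht x) = t (D.coord s l x) := by
  rw [coord, D.comp_map, WittVector.map_coeff]
  rfl

include D in
theorem wittFil_antitone {m m' : ℕ} (h : m ≤ m') : wittFil p R s m' ≤ wittFil p R s m := by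
  intro x hx
  rw [D.mem_wittFil_iff] at hx ⊢
  exact fun l hl => hx l (hl.trans_le h)

theorem mem_wittFil_succ_iff (m : ℕ) (x : WittExt p R s) :
    x ∈ wittFil p R s (m + 1) ↔ x ∈ wittFil p R s m ∧ D.coord s m x = 0 := by
  rw [D.mem_wittFil_iff, D.mem_wittFil_iff]
  refine ⟨fun h => ⟨fun l hl => h l (by omega), h m (by omega)⟩, fun h l hl => ?_⟩
  rcases Nat.lt_succ_iff_lt_or_eq.1 hl with h1 | rfl
  · exact h.1 l h1
  · exact h.2

theorem coord_congr {m : ℕ} {x y : WittExt p R s} (h : x - y ∈ wittFil p R s (m + 1)) :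
    D.coord s m x = D.coord s m y :=
  (D.sub_mem_wittFil_iff s _ x y).1 h m (Nat.lt_succ_self m)

/-- The leading term of an element of `𝓡^m(A)`. -/
theorem exists_sub_tmul_mem {m : ℕ} {x : WittExt p R s} (hx : x ∈ wittFil p R s m) :
    ∃ a : WittVector p A, a.coeff 0 = D.coord s m x ∧
      x - WittExt.tmul p R s (WittVector.verschiebung^[m / D.e] a) (D.ϖ ^ (m % D.e)) ∈
        wittFil p R s (m + 1) := by
  have hx' := (D.mem_wittFil_iff_truncate s m x).1 hx
  obtain ⟨a, ha, ha'⟩ := exists_eq_iterate_verschiebung (hx' ⟨m % D.e, Nat.mod_lt _ D.pos⟩)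
  dsimp only at ha ha'
  rw [D.digits_self] at ha ha'
  refine ⟨a, ha'.symm, ?_⟩
  rw [← ha]
  have h1 := D.eq_sum_tmul_comp s x
  rw [← Finset.add_sum_erase _ _ (Finset.mem_univ (⟨m % D.e, Nat.mod_lt _ D.pos⟩ : Fin D.e))] at h1
  rw [← sub_eq_iff_eq_add'] at h1
  rw [h1]
  refine sum_mem fun i hi => ?_
  obtain ⟨b, hb, -⟩ := exists_eq_iterate_verschiebung (hx' i)
  rw [hb]
  refine Ideal.subset_span ⟨_, b, _, ?_, rfl⟩
  -- From `m` to `m + 1` only the component in the residue class of `m` modulo `e` must gain a zero.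
  have h2 : D.digits (m + 1) i = D.digits m i := by
    refine eq_of_forall_lt_iff fun t => ?_
    rw [D.lt_digits_iff, D.lt_digits_iff]
    have h3 : i + t * D.e ≠ m := by
      rintro h4
      refine Finset.ne_of_mem_erase hi (Fin.ext ?_)
      dsimp only
      rw [← h4, Nat.add_mul_mod_self_right, Nat.mod_eq_of_lt i.2]
    omega
  rw [← h2]
  simpa using D.mem_pow_digits (m + 1) i 1

/-- Witt components are not additive in general, but on `𝓡^m(A)` the `m`-th coordinate is the
component of index zero after `V^(m / e)` is removed, and that component is additive. -/
theorem coord_add {m : ℕ} {x y : WittExt p R s} (hx : x ∈ wittFil p R s m)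
    (hy : y ∈ wittFil p R s m) : D.coord s m (x + y) = D.coord s m x + D.coord s m y := by
  rw [D.mem_wittFil_iff_truncate] at hx hy
  have hx' := hx ⟨m % D.e, Nat.mod_lt _ D.pos⟩
  have hy' := hy ⟨m % D.e, Nat.mod_lt _ D.pos⟩
  dsimp only at hx' hy'
  rw [D.digits_self] at hx' hy'
  obtain ⟨a, ha, ha'⟩ := exists_eq_iterate_verschiebung hx'
  obtain ⟨b, hb, hb'⟩ := exists_eq_iterate_verschiebung hy'
  rw [coord, coord, coord, ha', hb', map_add, ha, hb, ← iterate_map_add]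
  have := WittVector.iterate_verschiebung_coeff (a + b) (m / D.e) 0
  rw [zero_add] at this
  rw [this, WittVector.add_coeff_zero]

theorem coord_verschiebung_tmul {m : ℕ} (a : WittVector p A) :
    D.coord s m (WittExt.tmul p R s (WittVector.verschiebung^[m / D.e] a) (D.ϖ ^ (m % D.e))) =
      a.coeff 0 := by
  have h1 : D.repr (D.ϖ ^ (m % D.e)) ⟨m % D.e, Nat.mod_lt _ D.pos⟩ = 1 := by
    let := wittAlgebra p R
    have := D.basis_apply ⟨m % D.e, Nat.mod_lt _ D.pos⟩
    rw [repr, ← this, Module.Basis.repr_self, Finsupp.single_eq_same]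
  rw [coord, comp_tmul, h1, map_one, mul_one]
  simpa using WittVector.iterate_verschiebung_coeff a (m / D.e) 0

/-- Only the leading term `V^N(a) ⊗ ϖ ^ (m % e)` of `x` matters, with `N = m / e`. Multiplication by
`b` turns `a` into `a * F^N(b)`, which raises the residue of `b` to the power `p ^ N`. A scalar `r`
is moved into `W(A)` by a Teichmüller representative, at the cost of a multiple of `ϖ`, which lies
one step deeper. -/
theorem coord_mul {m : ℕ} {x : WittExt p R s} (hx : x ∈ wittFil p R s m) (y : WittExt p R s) :
    D.coord s m (y * x) = WittExt.reduction p R s y ^ p ^ (m / D.e) * D.coord s m x := by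
  rcases subsingleton_or_nontrivial A with hA | hA
  · exact Subsingleton.elim _ _
  have := charP_of_ringHom p s
  induction y using WittExt.induction with
  | zero =>
    rw [zero_mul, map_zero, zero_pow (pow_pos (Fact.out : p.Prime).pos _).ne', zero_mul,
      D.coord_zero_right]
  | add y z hy hz =>
    rw [add_mul, D.coord_add s (Ideal.mul_mem_left _ _ hx) (Ideal.mul_mem_left _ _ hx), hy, hz,
      map_add, add_pow_char_pow, add_mul]
  | tmul b r =>
    obtain ⟨a, ha, hxa⟩ := D.exists_sub_tmul_mem s hx
    let c := WittVector.teichmuller p (IsLocalRing.residue R r)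
    have hc : D.ϖ ∣ r - wittLift p R c := by
      rw [← Ideal.mem_span_singleton, ← D.irreducible.maximalIdeal_eq,
        ← IsLocalRing.residue_eq_zero_iff, map_sub, residue_wittLift,
        WittVector.teichmuller_coeff_zero, sub_self]
    obtain ⟨r', hr'⟩ := hc
    have hmul := Ideal.mul_mem_left _ (WittExt.tmul p R s b r) hxa
    rw [mul_sub] at hmul
    rw [D.coord_congr s hmul, WittExt.tmul_mul_tmul, eq_add_of_sub_eq' hr', add_mul,
      WittExt.tmul_add, mul_comm b, WittVector.iterate_verschiebung_mul_left,
      WittExt.tmul_wittLift_mul, WittVector.iterate_verschiebung_mul_left]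
    have h1 : WittExt.tmul p R s (WittVector.verschiebung^[m / D.e]
        (a * WittVector.frobenius^[m / D.e] b)) (D.ϖ * r' * D.ϖ ^ (m % D.e)) ∈
          wittFil p R s (m + 1) := by
      refine Ideal.subset_span ⟨_, _, _, ?_, rfl⟩
      have h2 := D.mem_pow_digits m (m % D.e) 1
      rw [D.digits_self, mul_one] at h2
      rw [mem_maximalIdeal_pow_iff D.irreducible] at h2 ⊢
      rw [pow_succ, show (p : R) ^ (m / D.e) * (D.ϖ * r' * D.ϖ ^ (m % D.e)) =
        (p : R) ^ (m / D.e) * D.ϖ ^ (m % D.e) * D.ϖ * r' by ring]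
      exact (mul_dvd_mul_right h2 _).mul_right _
    rw [D.coord_congr s (y := WittExt.tmul p R s (WittVector.verschiebung^[m / D.e]
        (a * WittVector.frobenius^[m / D.e] b * WittVector.frobenius^[m / D.e]
          (WittVector.map s c))) (D.ϖ ^ (m % D.e))) (by rwa [add_sub_cancel_left]),
      D.coord_verschiebung_tmul, WittVector.mul_coeff_zero, WittVector.mul_coeff_zero,
      WittVector.iterate_frobenius_coeff, WittVector.iterate_frobenius_coeff,
      WittVector.map_coeff, WittVector.teichmuller_coeff_zero, ha, WittExt.reduction_tmul,
      ← eq_add_of_sub_eq' hr']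
    ring

theorem coord_zero_eq_reduction (x : WittExt p R s) :
    D.coord s 0 x = WittExt.reduction p R s x := by
  have h1 := D.coord_mul s (m := 0) (x := 1) ((D.mem_wittFil_iff s 0 1).2 fun l hl => by omega) x
  have h2 : (1 : WittExt p R s) =
      WittExt.tmul p R s (WittVector.verschiebung^[0 / D.e] 1) (D.ϖ ^ (0 % D.e)) := by
    rw [Nat.zero_div, Nat.zero_mod, pow_zero]
    rfl
  have h3 : D.coord s 0 (1 : WittExt p R s) = 1 := by
    rw [h2, D.coord_verschiebung_tmul, WittVector.one_coeff_zero]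
  rw [mul_one, h3, mul_one, Nat.zero_div, pow_zero, pow_one] at h1
  exact h1

end Ramification

end Coordinates

/-! ### Étale algebras over filtered rings whose graded pieces are Frobenius twists -/

section Filtration

/-- A finite filtration of a ring `S` by ideals, with an identification of the `m`-th graded piece
with a ring `A`, on which `S` acts through the `p ^ (m / e)`-th power of a homomorphism `S → A`. -/
structure CoordFiltration (p e n : ℕ) (S A : Type u) [CommRing S] [CommRing A] where
  /-- the reduction -/
  red : S →+* A
  /-- the filtration -/
  fil : ℕ → Ideal S
  /-- the identification of the graded pieces with `A` -/
  coord : ℕ → S → A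
  fil_zero : fil 0 = ⊤
  fil_last : fil (n + 1) = ⊥
  mem_fil_succ_iff : ∀ m ≤ n, ∀ x, x ∈ fil (m + 1) ↔ x ∈ fil m ∧ coord m x = 0
  coord_add : ∀ m ≤ n, ∀ x ∈ fil m, ∀ y ∈ fil m, coord m (x + y) = coord m x + coord m y
  coord_mul : ∀ m ≤ n, ∀ x ∈ fil m, ∀ y, coord m (y * x) = red y ^ p ^ (m / e) * coord m x
  exists_coord_eq : ∀ m ≤ n, ∀ a, ∃ x ∈ fil m, coord m x = a
  coord_zero_eq_red : ∀ x, coord 0 x = red x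

namespace CoordFiltration

variable {p e n : ℕ} [Fact p.Prime] {S A : Type u} [CommRing S] [CommRing A]
  (F : CoordFiltration p e n S A)

omit [Fact p.Prime] in
theorem red_surjective : Function.Surjective F.red := fun a => by
  obtain ⟨x, -, hx⟩ := F.exists_coord_eq 0 (Nat.zero_le _) a
  exact ⟨x, by rw [← F.coord_zero_eq_red, hx]⟩

/-- Elements of the kernel of the reduction act as zero on graded pieces; this is the source of
nilpotency. -/
theorem mul_mem_fil_succ {m : ℕ} (hm : m ≤ n) {x y : S} (hy : F.red y = 0) (hx : x ∈ F.fil m) :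
    y * x ∈ F.fil (m + 1) := by
  rw [F.mem_fil_succ_iff m hm]
  refine ⟨Ideal.mul_mem_left _ _ hx, ?_⟩
  rw [F.coord_mul m hm x hx, hy, zero_pow (pow_pos (Fact.out : p.Prime).pos _).ne', zero_mul]

theorem pow_mem_fil {y : S} (hy : F.red y = 0) {m : ℕ} (hm : m ≤ n + 1) : y ^ m ∈ F.fil m := by
  induction m with
  | zero => rw [F.fil_zero]; trivial
  | succ m ih =>
    rw [pow_succ']
    exact F.mul_mem_fil_succ (by omega) hy (ih (by omega))

theorem ker_red_le_nilradical : RingHom.ker F.red ≤ nilradical S := fun y hy =>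
  ⟨n + 1, by simpa [F.fil_last] using F.pow_mem_fil hy le_rfl⟩

/-- The coordinate on the `m`-th piece of the filtration, as an additive homomorphism. -/
def coordHom (m : ℕ) (hm : m ≤ n) : F.fil m →+ A :=
  AddMonoidHom.mk' (fun x => F.coord m x) fun x y => F.coord_add m hm x x.2 y y.2

omit [Fact p.Prime] in
theorem coord_sub {m : ℕ} (hm : m ≤ n) {x y : S} (hx : x ∈ F.fil m) (hy : y ∈ F.fil m) :
    F.coord m (x - y) = F.coord m x - F.coord m y :=
  map_sub (F.coordHom m hm) ⟨x, hx⟩ ⟨y, hy⟩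

variable {T B C : Type u} [CommRing T] [CommRing B] [CommRing C] [Algebra S C] [Algebra A B]
  [Algebra.Etale A B] (G : CoordFiltration p e n T B) (ψ : C →+* T)

section Bijective

variable (hp : (p : A) = 0)
  (hred : ∀ x, G.red (ψ (algebraMap S C x)) = algebraMap A B (F.red x))
  (hcoord : ∀ m ≤ n, ∀ x ∈ F.fil m, G.coord m (ψ (algebraMap S C x)) =
    algebraMap A B (F.coord m x))
  (hsurj : Function.Surjective (G.red.comp ψ))
  (hker : RingHom.ker (G.red.comp ψ) = (RingHom.ker F.red).map (algebraMap S C))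

omit [Fact p.Prime] [Algebra.Etale A B] in
include hcoord in
theorem map_mem_fil {m : ℕ} (hm : m ≤ n + 1) {x : S} (hx : x ∈ F.fil m) :
    ψ (algebraMap S C x) ∈ G.fil m := by
  induction m generalizing x with
  | zero => rw [G.fil_zero]; trivial
  | succ m ih =>
    rw [F.mem_fil_succ_iff m (by omega)] at hx
    rw [G.mem_fil_succ_iff m (by omega)]
    exact ⟨ih (by omega) hx.1, by rw [hcoord m (by omega) x hx.1, hx.2, map_zero]⟩

include hp hcoord hsurj in
-- One step of successive approximation. The image of `c * x`, with `x` in the `m`-th ideal of `S`,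
-- has coordinate `a * b ^ p ^ (m / e)`, and sums of such elements exhaust `B`.
theorem exists_sub_mem_fil {m : ℕ} (hm : m ≤ n) {y : T} (hy : y ∈ G.fil m) :
    ∃ c : C, y - ψ c ∈ G.fil (m + 1) := by
  have key : ∀ b : B, ∃ c : C, ψ c ∈ G.fil m ∧ G.coord m (ψ c) = b := by
    intro b
    have hb : b ∈ AddSubgroup.closure
        {x : B | ∃ a b, x = algebraMap A B a * b ^ p ^ (m / e)} := by
      rw [closure_mul_pow_eq_top hp]
      trivial
    refine AddSubgroup.closure_induction ?_ ?_ ?_ ?_ hb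
    · rintro _ ⟨a, b, rfl⟩
      obtain ⟨x, hx, rfl⟩ := F.exists_coord_eq m hm a
      obtain ⟨c, rfl⟩ := hsurj b
      have h1 := map_mem_fil F G ψ hcoord (by omega) hx
      refine ⟨c * algebraMap S C x, ?_, ?_⟩
      · rw [map_mul]
        exact Ideal.mul_mem_left _ _ h1
      · rw [map_mul, G.coord_mul m hm _ h1, hcoord m hm x hx, mul_comm]
        rfl
    · refine ⟨0, ?_, ?_⟩
      · rw [map_zero]; exact zero_mem _
      · rw [map_zero]; exact map_zero (G.coordHom m hm)
    · rintro _ _ _ _ ⟨c, hc, rfl⟩ ⟨d, hd, rfl⟩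
      refine ⟨c + d, ?_, ?_⟩
      · rw [map_add]; exact add_mem hc hd
      · rw [map_add, G.coord_add m hm _ hc _ hd]
    · rintro _ _ ⟨c, hc, rfl⟩
      refine ⟨-c, ?_, ?_⟩
      · rw [map_neg]; exact neg_mem hc
      · rw [map_neg]; exact map_neg (G.coordHom m hm) ⟨_, hc⟩
  obtain ⟨c, hc, hc'⟩ := key (G.coord m y)
  refine ⟨c, (G.mem_fil_succ_iff m hm _).2 ⟨sub_mem hy hc, ?_⟩⟩
  rw [G.coord_sub hm hy hc, hc', sub_self]

include F hp hcoord hsurj in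
theorem surjective_of_etale : Function.Surjective ψ := by
  -- Induction from the deepest ideal, which is zero, upwards.
  have key : ∀ l ≤ n + 1, ∀ y ∈ G.fil (n + 1 - l), ∃ c, ψ c = y := by
    intro l hl
    induction l with
    | zero =>
      intro y hy
      rw [Nat.sub_zero, G.fil_last] at hy
      exact ⟨0, by rw [map_zero, (Ideal.mem_bot).1 hy]⟩
    | succ l ih =>
      intro y hy
      obtain ⟨c, hc⟩ := exists_sub_mem_fil F G ψ hp hcoord hsurj (by omega) hy
      rw [show n + 1 - (l + 1) + 1 = n + 1 - l by omega] at hc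
      obtain ⟨d, hd⟩ := ih (by omega) _ hc
      exact ⟨d + c, by rw [map_add, hd, sub_add_cancel]⟩
  intro y
  exact key (n + 1) le_rfl y (by rw [Nat.sub_self, G.fil_zero]; trivial)

omit [Fact p.Prime] [Algebra.Etale A B] in
include hcoord in
theorem map_mem_fil_of_mem_map {m : ℕ} (hm : m ≤ n + 1) {c : C}
    (hc : c ∈ (F.fil m).map (algebraMap S C)) : ψ c ∈ G.fil m := by
  have : (F.fil m).map (algebraMap S C) ≤ (G.fil m).comap ψ :=
    Ideal.map_le_iff_le_comap.2 fun x hx => map_mem_fil F G ψ hcoord hm hx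
  exact this hc

omit [Algebra A B] [Algebra.Etale A B] in
include hker in
theorem algebraMap_mul_mem {m : ℕ} (hm : m ≤ n) {x : S} (hx : x ∈ F.fil m) {c : C}
    (hc : G.red (ψ c) = 0) : algebraMap S C x * c ∈ (F.fil (m + 1)).map (algebraMap S C) := by
  have h1 : c ∈ (RingHom.ker F.red).map (algebraMap S C) := by
    rw [← hker]
    exact hc
  have h2 : (RingHom.ker F.red).map (algebraMap S C) ≤
      Submodule.comap (LinearMap.mulLeft C (algebraMap S C x))
        ((F.fil (m + 1)).map (algebraMap S C)) := by
    refine Ideal.span_le.2 ?_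
    rintro _ ⟨y, hy, rfl⟩
    change algebraMap S C x * algebraMap S C y ∈ (F.fil (m + 1)).map (algebraMap S C)
    rw [← map_mul, mul_comm x]
    exact Ideal.mem_map_of_mem _ (F.mul_mem_fil_succ hm hy hx)
  exact h2 h1

include hp hred hcoord hsurj hker in
-- Injectivity on graded pieces, without flatness of `C`. The pairing of `a` and `b`, the class of a
-- product of lifts in `C ⧸ J`, is balanced over the Frobenius twist. It therefore factors through
-- an additive map `H` on `B` that recovers the class of an element from the `m`-th coordinate of
-- its image under `ψ`. If that coordinate vanishes, so does the class.
theorem mem_map_fil_succ {m : ℕ} (hm : m ≤ n) {c : C}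
    (hc : c ∈ (F.fil m).map (algebraMap S C)) (hc' : ψ c ∈ G.fil (m + 1)) :
    c ∈ (F.fil (m + 1)).map (algebraMap S C) := by
  let J := (F.fil (m + 1)).map (algebraMap S C)
  choose x hx hxa using F.exists_coord_eq m hm
  choose d hd using hsurj
  change ∀ b, G.red (ψ (d b)) = b at hd
  let v : A → B → C ⧸ J := fun a b => Ideal.Quotient.mk J (algebraMap S C (x a) * d b)
  -- Independence of the chosen lifts: changing `x` moves one step down the filtration, and changing
  -- `d` adds an element of the ideal generated by the kernel of the reduction.
  have hv : ∀ y ∈ F.fil m, ∀ c, v (F.coord m y) (G.red (ψ c)) =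
      Ideal.Quotient.mk J (algebraMap S C y * c) := by
    intro y hy c
    refine (Ideal.Quotient.eq).2 ?_
    have h1 : x (F.coord m y) - y ∈ F.fil (m + 1) := (F.mem_fil_succ_iff m hm _).2
      ⟨sub_mem (hx _) hy, by rw [F.coord_sub hm (hx _) hy, hxa, sub_self]⟩
    have h2 : algebraMap S C (x (F.coord m y)) * d (G.red (ψ c)) - algebraMap S C y * c =
        algebraMap S C (x (F.coord m y) - y) * d (G.red (ψ c)) +
          algebraMap S C y * (d (G.red (ψ c)) - c) := by
      rw [map_sub]; ring
    rw [h2]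
    refine add_mem (Ideal.mul_mem_right _ _ (Ideal.mem_map_of_mem _ h1))
      (algebraMap_mul_mem F G ψ hker hm hy ?_)
    rw [map_sub, map_sub, hd, sub_self]
  have hv' : ∀ y ∈ F.fil m, ∀ b, v (F.coord m y) b =
      Ideal.Quotient.mk J (algebraMap S C y * d b) := by
    intro y hy b
    have := hv y hy (d b)
    rwa [hd] at this
  have hv'' : ∀ a c, v a (G.red (ψ c)) = Ideal.Quotient.mk J (algebraMap S C (x a) * c) := by
    intro a c
    have := hv (x a) (hx a) c
    rwa [hxa] at this
  let g : A →+ B →+ C ⧸ J :=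
    AddMonoidHom.mk' (fun a => AddMonoidHom.mk' (v a) fun b b' => by
      rw [← hd b, ← hd b', ← map_add, ← map_add, hv'', hv'', hv'', mul_add, map_add])
      fun a a' => by
        ext b
        change v (a + a') b = v a b + v a' b
        rw [← hxa a, ← hxa a', ← F.coord_add m hm _ (hx a) _ (hx a'),
          hv' _ (add_mem (hx a) (hx a')), hv' _ (hx a), hv' _ (hx a'), map_add, add_mul, map_add]
  obtain ⟨H, hH⟩ := exists_addMonoidHom_of_balanced hp (m / e) g fun z a b => by
    change v _ _ = v _ _
    obtain ⟨y, rfl⟩ := F.red_surjective z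
    rw [← hxa a, ← F.coord_mul m hm _ (hx a), ← hd b, ← hred, ← map_mul, ← map_mul,
      hv _ (Ideal.mul_mem_left _ _ (hx a)), hv _ (hx a), (algebraMap S C).map_mul, mul_left_comm,
      mul_assoc, mul_left_comm]
  have key : ∀ z (_ : z ∈ (F.fil m).map (algebraMap S C)),
      ψ z ∈ G.fil m ∧ H (G.coord m (ψ z)) = Ideal.Quotient.mk J z := by
    intro z hz
    refine ⟨map_mem_fil_of_mem_map F G ψ hcoord (by omega) hz, ?_⟩
    -- The claim is made for all multiples `c * z`, which makes it stable under scalars; the case `c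
    -- = 1` is the one wanted.
    refine Submodule.span_induction
      (p := fun z _ => ∀ c, ψ z ∈ G.fil m ∧ H (G.coord m (ψ (c * z))) =
        Ideal.Quotient.mk J (c * z)) ?_ ?_ ?_ ?_ hz 1 |>.2 |> fun h => by rwa [one_mul] at h
    · rintro _ ⟨y, hy, rfl⟩ c
      have h1 := map_mem_fil F G ψ hcoord (by omega) hy
      refine ⟨h1, ?_⟩
      rw [map_mul, G.coord_mul m hm _ h1, hcoord m hm y hy, mul_comm, hH]
      change v _ _ = _
      rw [hv y hy, mul_comm]
    · intro c
      rw [mul_zero, map_zero, map_zero]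
      exact ⟨zero_mem _, (congrArg H (map_zero (G.coordHom m hm))).trans (map_zero H)⟩
    · intro z w _ _ hz hw c
      refine ⟨by rw [map_add]; exact add_mem (hz 1).1 (hw 1).1, ?_⟩
      rw [mul_add, map_add, G.coord_add m hm, map_add, (hz c).2, (hw c).2, map_add]
      · rw [map_mul]; exact Ideal.mul_mem_left _ _ (hz 1).1
      · rw [map_mul]; exact Ideal.mul_mem_left _ _ (hw 1).1
    · intro c' z _ hz c
      refine ⟨by rw [smul_eq_mul, map_mul]; exact Ideal.mul_mem_left _ _ (hz 1).1, ?_⟩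
      rw [smul_eq_mul, ← mul_assoc]
      exact (hz _).2
  have h1 := (key c hc).2
  rw [((G.mem_fil_succ_iff m hm _).1 hc').2, map_zero] at h1
  exact Ideal.Quotient.eq_zero_iff_mem.1 h1.symm

include F hp hred hcoord hsurj hker in
/-- An algebra over a filtered ring `S` that lifts an étale algebra `B` over `A` is isomorphic to
any compatible filtered ring over `B`. -/
theorem bijective_of_etale : Function.Bijective ψ := by
  refine ⟨(injective_iff_map_eq_zero ψ).2 fun c hc => ?_,
    surjective_of_etale F G ψ hp hcoord hsurj⟩
  have key : ∀ m ≤ n + 1, c ∈ (F.fil m).map (algebraMap S C) := by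
    intro m hm
    induction m with
    | zero => rw [F.fil_zero, Ideal.map_top]; trivial
    | succ m ih =>
      refine mem_map_fil_succ F G ψ hp hred hcoord hsurj hker (by omega) (ih (by omega)) ?_
      rw [hc]
      exact zero_mem _
  simpa [F.fil_last, Ideal.map_bot] using key (n + 1) le_rfl

end Bijective

end CoordFiltration

end Filtration

/-! ### The filtration of `𝓡_n(A)` -/

section WittCoordinates

variable {p : ℕ} [Fact p.Prime] {R : Type u} [CommRing R] [IsDomain R]
  [IsDiscreteValuationRing R] [CharP (IsLocalRing.ResidueField R) p]
  [PerfectRing (IsLocalRing.ResidueField R) p] [IsAdicComplete (IsLocalRing.maximalIdeal R) R]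

namespace Ramification

variable (D : Ramification p R) {A : Type u} [CommRing A] (s : IsLocalRing.ResidueField R →+* A)
  (n : ℕ)

/-- The `l`-th coordinate of an element of `𝓡_n(A)`. -/
def quotCoord (l : ℕ) (x : WittThickening p R s n) : A :=
  D.coord s l (Function.surjInv Ideal.Quotient.mk_surjective x)

variable {n} in
theorem quotCoord_mk {l : ℕ} (hl : l ≤ n) (x : WittExt p R s) :
    D.quotCoord s n l (Ideal.Quotient.mk _ x) = D.coord s l x := by
  refine (D.sub_mem_wittFil_iff s (n + 1) _ _).1 ?_ l (by omega)
  rw [← Ideal.Quotient.eq]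
  exact Function.surjInv_eq _ _

variable {n} in
theorem quotCoord_map {B : Type u} [CommRing B] {s' : IsLocalRing.ResidueField R →+* B}
    (t : A →+* B) (ht : t.comp s = s') {l : ℕ} (hl : l ≤ n) (x : WittThickening p R s n) :
    D.quotCoord s' n l (WittThickening.map p R t ht n x) = t (D.quotCoord s n l x) := by
  obtain ⟨x, rfl⟩ := Ideal.Quotient.mk_surjective x
  rw [D.quotCoord_mk s hl, ← D.coord_map t ht]
  exact D.quotCoord_mk s' hl _

theorem bijective_quotCoord :
    Function.Bijective fun (x : WittThickening p R s n) (l : Fin (n + 1)) =>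
      D.quotCoord s n l x := by
  constructor
  · intro x y h
    obtain ⟨x, rfl⟩ := Ideal.Quotient.mk_surjective x
    obtain ⟨y, rfl⟩ := Ideal.Quotient.mk_surjective y
    rw [Ideal.Quotient.eq, D.sub_mem_wittFil_iff]
    intro l hl
    have := congrFun h ⟨l, hl⟩
    dsimp only at this
    rwa [D.quotCoord_mk s (by omega), D.quotCoord_mk s (by omega)] at this
  · intro f
    obtain ⟨x, hx⟩ := D.exists_coord_eq s fun l => if h : l < n + 1 then f ⟨l, h⟩ else 0
    refine ⟨Ideal.Quotient.mk _ x, funext fun l => ?_⟩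
    dsimp only
    rw [D.quotCoord_mk s (by omega), hx, dif_pos l.2]

include D in
theorem mk_mem_map_wittFil_iff {m : ℕ} (hm : m ≤ n + 1) (x : WittExt p R s) :
    Ideal.Quotient.mk (wittFil p R s (n + 1)) x ∈
      (wittFil p R s m).map (Ideal.Quotient.mk (wittFil p R s (n + 1))) ↔ x ∈ wittFil p R s m :=
  Ideal.mem_quotient_iff_mem (D.wittFil_antitone s hm)

/-- The filtration of `𝓡_n(A)` by the images of the ideals `𝓡^m(A)`. -/
def coordFiltration : CoordFiltration p D.e n (WittThickening p R s n) A where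
  red := WittThickening.reduction p R s n
  fil m := (wittFil p R s m).map (Ideal.Quotient.mk _)
  coord := D.quotCoord s n
  fil_zero := by
    rw [Ideal.eq_top_iff_one, ← map_one (Ideal.Quotient.mk _),
      D.mk_mem_map_wittFil_iff s n (Nat.zero_le _), D.mem_wittFil_iff]
    exact fun l hl => absurd hl (Nat.not_lt_zero l)
  fil_last := Ideal.map_quotient_self _
  mem_fil_succ_iff m hm x := by
    obtain ⟨x, rfl⟩ := Ideal.Quotient.mk_surjective x
    rw [D.mk_mem_map_wittFil_iff s n (by omega), D.mk_mem_map_wittFil_iff s n (by omega),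
      D.quotCoord_mk s hm, D.mem_wittFil_succ_iff]
  coord_add m hm x hx y hy := by
    obtain ⟨x, rfl⟩ := Ideal.Quotient.mk_surjective x
    obtain ⟨y, rfl⟩ := Ideal.Quotient.mk_surjective y
    rw [D.mk_mem_map_wittFil_iff s n (by omega)] at hx hy
    rw [← map_add, D.quotCoord_mk s hm, D.quotCoord_mk s hm, D.quotCoord_mk s hm,
      D.coord_add s hx hy]
  coord_mul m hm x hx y := by
    obtain ⟨x, rfl⟩ := Ideal.Quotient.mk_surjective x
    obtain ⟨y, rfl⟩ := Ideal.Quotient.mk_surjective y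
    rw [D.mk_mem_map_wittFil_iff s n (by omega)] at hx
    rw [← map_mul, D.quotCoord_mk s hm, D.quotCoord_mk s hm, D.coord_mul s hx]
    rfl
  exists_coord_eq m hm a := by
    obtain ⟨x, hx⟩ := D.exists_coord_eq s fun l => if l = m then a else 0
    refine ⟨Ideal.Quotient.mk _ x, ?_, ?_⟩
    · rw [D.mk_mem_map_wittFil_iff s n (by omega), D.mem_wittFil_iff]
      intro l hl
      rw [hx, if_neg hl.ne]
    · rw [D.quotCoord_mk s hm, hx, if_pos rfl]
  coord_zero_eq_red x := by
    obtain ⟨x, rfl⟩ := Ideal.Quotient.mk_surjective x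
    rw [D.quotCoord_mk s (Nat.zero_le _), D.coord_zero_eq_reduction]
    rfl

end Ramification

end WittCoordinates

/-! ### Étale algebras over filtered rings -/

namespace CoordFiltration

variable {p e n : ℕ} [Fact p.Prime] {S A T B : Type u} [CommRing S] [CommRing A]
  [CommRing T] [CommRing B] [Algebra S T] [Algebra A B] [Algebra.Etale A B]
  (F : CoordFiltration p e n S A) (G : CoordFiltration p e n T B) (hp : (p : A) = 0)
  (hcoord : ∀ m ≤ n, ∀ x, G.coord m (algebraMap S T x) = algebraMap A B (F.coord m x))

theorem isNilpotent_ker_red : IsNilpotent (RingHom.ker F.red) := by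
  refine ⟨n + 1, ?_⟩
  have key : ∀ m ≤ n + 1, RingHom.ker F.red ^ m ≤ F.fil m := by
    intro m hm
    induction m with
    | zero => rw [F.fil_zero]; exact le_top
    | succ m ih =>
      rw [pow_succ, Ideal.mul_le]
      intro x hx y hy
      rw [mul_comm]
      exact F.mul_mem_fil_succ (by omega) hy (ih (by omega) hx)
  simpa [F.fil_last] using key (n + 1) le_rfl

omit [Fact p.Prime] [Algebra.Etale A B] in
include hcoord in
theorem red_algebraMap (x : S) : G.red (algebraMap S T x) = algebraMap A B (F.red x) := by
  rw [← F.coord_zero_eq_red, ← G.coord_zero_eq_red, hcoord 0 (Nat.zero_le _)]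

include F G hp hcoord in
-- An étale lift `C` of `B` over `S` maps to `T`, since `T → B` has nilpotent kernel and `C` is
-- formally smooth; graded bijectivity identifies `C` with `T`.
theorem etale : Algebra.Etale S T := by
  let : Algebra S A := F.red.toAlgebra
  let : Algebra S B := ((algebraMap A B).comp F.red).toAlgebra
  have : IsScalarTower S A B := .of_algebraMap_eq fun _ => rfl
  obtain ⟨C, _, _, _, π, hπ, hπ'⟩ := exists_etale_lift (S := S) (A := A) (B := B)
    F.red_surjective F.ker_red_le_nilradical
  let g : T →ₐ[S] B := ⟨G.red, F.red_algebraMap G hcoord⟩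
  have hg : IsNilpotent (RingHom.ker (g : T →+* B)) := G.isNilpotent_ker_red
  let ψ : C →ₐ[S] T := Algebra.FormallySmooth.liftOfSurjective π g G.red_surjective hg
  have hψ : ∀ c, G.red (ψ c) = π c :=
    Algebra.FormallySmooth.liftOfSurjective_apply π g G.red_surjective hg
  have hψ' : G.red.comp (ψ : C →+* T) = π := RingHom.ext hψ
  have hb : Function.Bijective ψ :=
    F.bijective_of_etale G (ψ : C →+* T) hp
      (fun x => by rw [RingHom.coe_coe, ψ.commutes, F.red_algebraMap G hcoord])
      (fun m hm x _ => by rw [RingHom.coe_coe, ψ.commutes, hcoord m hm])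
      (by rw [hψ']; exact hπ) (by rw [hψ']; exact hπ')
  exact Algebra.Etale.of_equiv (AlgEquiv.ofBijective ψ hb)

omit [Algebra.Etale A B] in
include F G hp hcoord in
-- The localization of `S` at `x` takes the role of the étale lift of `B`. It maps to `T` because
-- `x` is a unit there, its reduction being one.
theorem isLocalization_away (x : S) [IsLocalization.Away (F.red x) B] :
    IsLocalization.Away x T := by
  have : Algebra.Etale A B := Algebra.Etale.of_isLocalizationAway (F.red x)
  have hx : IsUnit (algebraMap S T x) := by
    obtain ⟨y, hy⟩ := (IsLocalization.Away.algebraMap_isUnit (S := B) (F.red x)).exists_right_inv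
    obtain ⟨y, rfl⟩ := G.red_surjective y
    rw [← F.red_algebraMap G hcoord, ← map_mul, ← sub_eq_zero, ← map_one G.red, ← map_sub] at hy
    have h1 : IsNilpotent (algebraMap S T x * y - 1) := G.ker_red_le_nilradical hy
    have h2 := h1.isUnit_add_one
    rw [sub_add_cancel] at h2
    exact isUnit_of_mul_isUnit_left h2
  let ψ : Localization.Away x →ₐ[S] T :=
    ⟨IsLocalization.Away.lift x hx, IsLocalization.Away.lift_eq x hx⟩
  have hM : Submonoid.map F.red (Submonoid.powers x) = Submonoid.powers (F.red x) :=
    Submonoid.map_powers ..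
  have hψ : G.red.comp (ψ : Localization.Away x →+* T) =
      IsLocalization.map B F.red (M := Submonoid.powers x) (T := Submonoid.powers (F.red x))
        (Submonoid.map_le_iff_le_comap.1 hM.le) := by
    refine IsLocalization.ringHom_ext (Submonoid.powers x) (RingHom.ext fun y => ?_)
    rw [RingHom.comp_apply, RingHom.comp_apply, RingHom.comp_apply, IsLocalization.map_eq,
      RingHom.coe_coe, ψ.commutes, F.red_algebraMap G hcoord]
  have hb : Function.Bijective ψ :=
    F.bijective_of_etale G (ψ : Localization.Away x →+* T) hp
      (fun x => by rw [RingHom.coe_coe, ψ.commutes, F.red_algebraMap G hcoord])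
      (fun m hm x _ => by rw [RingHom.coe_coe, ψ.commutes, hcoord m hm])
      (by
        rw [hψ]
        have : IsLocalization (Submonoid.map F.red (Submonoid.powers x)) B := by
          rw [hM]; infer_instance
        intro b
        obtain ⟨b, rfl⟩ := IsLocalization.map_surjective_of_surjective (Submonoid.powers x)
          (Localization.Away x) B F.red_surjective b
        refine ⟨b, ?_⟩
        congr 1)
      (by
        rw [hψ]
        exact IsLocalization.ker_map _ _ hM)
  exact IsLocalization.isLocalization_of_algEquiv _ (AlgEquiv.ofBijective ψ hb)

end CoordFiltration

/-! ### Functors that behave like infinitesimal thickenings -/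

section Thickening

variable {k : CommRingCat.{u}}

/-- A functor `F` from `k`-algebras to rings with a surjection `ε : F(A) → A` that has a nil kernel,
such that the set `F(A)` is naturally a power of `A` and such that `F` preserves localizations at one
element and étale homomorphisms. -/
structure IsThickening (F : Under k ⥤ CommRingCat.{u}) (ε : F ⟶ Under.forget k) : Prop where
  surjective (A : Under k) : Function.Surjective (ε.app A).hom
  isNilpotent (A : Under k) (x : F.obj A) : (ε.app A).hom x = 0 → IsNilpotent x
  exists_coord : ∃ (ι : Type u) (c : ∀ A : Under k, F.obj A → ι → A.right),
    (∀ A, Function.Bijective (c A)) ∧ ∀ (A B : Under k) (t : A ⟶ B) (x : F.obj A) (i : ι),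
      c B ((F.map t).hom x) i = t.right.hom (c A x i)
  isLocalization_away {A B : Under k} (t : A ⟶ B) (x : F.obj A) (f : A.right) :
    letI := t.right.hom.toAlgebra
    letI := (F.map t).hom.toAlgebra
    (ε.app A).hom x = f → IsLocalization.Away f B.right → IsLocalization.Away x (F.obj B)
  etale {A B : Under k} (t : A ⟶ B) : t.right.hom.Etale → (F.map t).hom.Etale

theorem isThickening_wittFunctor (p : ℕ) [Fact p.Prime] (R : Type u) [CommRing R] [IsDomain R]
    [IsDiscreteValuationRing R] [CharZero R] [CharP (IsLocalRing.ResidueField R) p]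
    [PerfectRing (IsLocalRing.ResidueField R) p] [IsAdicComplete (IsLocalRing.maximalIdeal R) R]
    (n : ℕ) : IsThickening (wittFunctor p R n) (wittReduction p R n) := by
  obtain ⟨D⟩ := exists_ramification p R
  refine ⟨fun A => (D.coordFiltration A.hom.hom n).red_surjective,
    fun A x hx => (D.coordFiltration A.hom.hom n).ker_red_le_nilradical hx,
    ⟨ULift (Fin (n + 1)), fun A x l => D.quotCoord A.hom.hom n l.down x, fun A => ?_,
      fun A B t x l => ?_⟩, fun {A B} t x f => ?_, fun {A B} t ht => ?_⟩
  · exact (Equiv.bijective (Equiv.piCongrLeft' (fun _ => A.right) Equiv.ulift.symm)).comp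
      (D.bijective_quotCoord A.hom.hom n)
  · exact D.quotCoord_map _ t.right.hom _ (Nat.lt_succ_iff.1 l.down.2) x
  · let := t.right.hom.toAlgebra
    let : Algebra (WittThickening p R A.hom.hom n) (WittThickening p R B.hom.hom n) :=
      ((wittFunctor p R n).map t).hom.toAlgebra
    rintro rfl h
    have : IsLocalization.Away ((D.coordFiltration A.hom.hom n).red x) B.right := h
    exact (D.coordFiltration A.hom.hom n).isLocalization_away (D.coordFiltration B.hom.hom n)
      (natCast_eq_zero_of_ringHom p A.hom.hom)
      (fun m hm x => D.quotCoord_map _ t.right.hom _ hm x) x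
  · let := t.right.hom.toAlgebra
    let : Algebra (WittThickening p R A.hom.hom n) (WittThickening p R B.hom.hom n) :=
      ((wittFunctor p R n).map t).hom.toAlgebra
    change Algebra.Etale (WittThickening p R A.hom.hom n) (WittThickening p R B.hom.hom n)
    have : Algebra.Etale A.right B.right := ht
    exact (D.coordFiltration A.hom.hom n).etale (D.coordFiltration B.hom.hom n)
      (natCast_eq_zero_of_ringHom p A.hom.hom)
      (fun m hm x => D.quotCoord_map _ t.right.hom _ hm x)

end Thickening

/-! ### The ringed space `(|X|, F(𝒪_X))` is a locally ringed space -/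

/-- Applied to `X → (|X|, F(𝒪_X))`, the identity on points, it deduces locality of the induced map
of thickenings from locality of a morphism of schemes. -/
theorem isLocalHom_stalkMap_of_comp {X Y Z : PresheafedSpace.{_, _, u} CommRingCat.{u}}
    (f : X ⟶ Y) (g : Y ⟶ Z) (h : X ⟶ Z) (w : f ≫ g = h) (x : X)
    (hx : IsLocalHom (PresheafedSpace.Hom.stalkMap h x).hom) :
    IsLocalHom (PresheafedSpace.Hom.stalkMap g (f.base x)).hom := by
  subst w
  refine ⟨fun a ha => hx.1 a ?_⟩
  have h1 : (PresheafedSpace.Hom.stalkMap (f ≫ g) x).hom a =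
      (PresheafedSpace.Hom.stalkMap f x).hom
        ((PresheafedSpace.Hom.stalkMap g (f.base x)).hom a) :=
    congrArg (fun φ => φ.hom a) (PresheafedSpace.stalkMap.comp f g x)
  rw [h1]
  exact ha.map _

section LocallyRinged

variable {k : CommRingCat.{u}} {F : Under k ⥤ CommRingCat.{u}} {ε : F ⟶ Under.forget k}
  (hF : IsThickening F ε)

variable (ε) in
/-- The homomorphism `F(Γ(X, U)) → Γ(X, U)`. -/
def redSection (X : Over (Spec k)) (U : X.left.Opens) :
    F.obj ((sectionsUnder X).obj (op U)) →+* Γ(X.left, U) :=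
  (ε.app ((sectionsUnder X).obj (op U))).hom

theorem redSection_map {X : Over (Spec k)} {U V : X.left.Opens} (i : V ⟶ U)
    (s : F.obj ((sectionsUnder X).obj (op U))) :
    redSection ε X V ((F.map ((sectionsUnder X).map i.op)).hom s) =
      (X.left.presheaf.map i.op).hom (redSection ε X U s) :=
  ConcreteCategory.congr_hom (ε.naturality ((sectionsUnder X).map i.op)) s

theorem stalkMap_tildeIncl_germ {X : Over (Spec k)} (x : X.left) {U : X.left.Opens} (hx : x ∈ U)
    (s : F.obj ((sectionsUnder X).obj (op U))) :
    (PresheafedSpace.Hom.stalkMap ((tildeIncl F ε).app X) x).hom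
      ((((tilde F).obj X).presheaf.germ U x hx).hom s) =
        (X.left.presheaf.germ U x hx).hom (redSection ε X U s) :=
  PresheafedSpace.stalkMap_germ_apply ((tildeIncl F ε).app X) U x hx s

include hF

namespace IsThickening

theorem isUnit_iff (A : Under k) (x : F.obj A) : IsUnit ((ε.app A).hom x) ↔ IsUnit x := by
  refine ⟨fun h => ?_, fun h => h.map _⟩
  obtain ⟨y, hy⟩ := h.exists_right_inv
  obtain ⟨y, rfl⟩ := hF.surjective A y
  have h1 := hF.isNilpotent A (x * y - 1) (by rw [map_sub, map_mul, hy, map_one, sub_self])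
  have h2 := h1.isUnit_add_one
  rw [sub_add_cancel] at h2
  exact isUnit_of_mul_isUnit_left h2

/-- Through the coordinates, the presheaf of sets underlying `F(𝒪_X)` is a power of `𝒪_X`, so
sections glue coordinate by coordinate. -/
theorem isSheaf (X : Over (Spec k)) :
    TopCat.Presheaf.IsSheaf (X := X.left.carrier) (sectionsUnder X ⋙ F) := by
  obtain ⟨ι, c, hc, hc'⟩ := hF.exists_coord
  rw [TopCat.Presheaf.isSheaf_iff_isSheaf_comp (CategoryTheory.forget CommRingCat)]
  refine TopCat.Presheaf.isSheaf_of_isSheafUniqueGluing_types _ fun J U sf hsf => ?_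
  have hn : ∀ {V W : (Opens X.left)ᵒᵖ} (i : V ⟶ W) (x : F.obj ((sectionsUnder X).obj V)) (l : ι),
      c _ ((F.map ((sectionsUnder X).map i)).hom x) l = (X.left.presheaf.map i).hom (c _ x l) :=
    fun i x l => hc' _ _ _ x l
  have key : ∀ l, ∃! t : X.left.presheaf.obj (op (iSup U)),
      ∀ j, (X.left.presheaf.map (Opens.leSupr U j).op).hom t = c _ (sf j) l := by
    intro l
    refine X.left.sheaf.existsUnique_gluing U (fun j => c _ (sf j) l) fun i j => ?_
    exact (hn _ _ l).symm.trans ((congrFun (congrArg (c _) (hsf i j)) l).trans (hn _ _ l))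
  choose t ht ht' using key
  obtain ⟨s, hs⟩ := (hc ((sectionsUnder X).obj (op (iSup U)))).2 t
  refine ⟨s, fun j => (hc _).1 (funext fun l => ?_), fun s' hs' => (hc _).1 (funext fun l => ?_)⟩
  · exact (hn _ s l).trans ((congrArg _ (congrFun hs l)).trans (ht l j))
  · refine (ht' l _ fun j => ?_).trans (congrFun hs l).symm
    exact (hn _ s' l).symm.trans (congrFun (congrArg (c _) (hs' j)) l)

/-- A germ with invertible reduction has invertible reduction on a neighbourhood, and there the nil
kernel makes the section itself a unit. Stalks of `F(𝒪_X)` are then local, because those of `𝒪_X`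
are. -/
theorem isLocalHom_stalkMap_tildeIncl (X : Over (Spec k)) (x : X.left) :
    IsLocalHom (PresheafedSpace.Hom.stalkMap ((tildeIncl F ε).app X) x).hom := by
  refine ⟨fun a ha => ?_⟩
  obtain ⟨U, hx, s, rfl⟩ := TopCat.Presheaf.exists_germ_eq (X := X.left.carrier)
    (sectionsUnder X ⋙ F) (x := x) a
  replace ha : IsUnit ((X.left.presheaf.germ U x hx).hom (redSection ε X U s)) := by
    rw [← stalkMap_tildeIncl_germ x hx s]
    exact ha
  obtain ⟨V, i, hxV, hV⟩ := X.left.toRingedSpace.isUnit_res_of_isUnit_germ U _ x hx ha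
  have h2 : IsUnit ((F.map ((sectionsUnder X).map i.op)).hom s) := by
    refine (hF.isUnit_iff _ _).1 ?_
    have h3 := redSection_map (ε := ε) i s
    change IsUnit (redSection ε X V ((F.map ((sectionsUnder X).map i.op)).hom s))
    rw [h3]
    exact hV
  rw [← TopCat.Presheaf.germ_res_apply (X := X.left.carrier) (sectionsUnder X ⋙ F) i x hxV s]
  exact h2.map _

end IsThickening

/-- The locally ringed space `(|X|, F(𝒪_X))`. -/
def tildeLRS (X : Over (Spec k)) : LocallyRingedSpace.{u} where
  toPresheafedSpace := (tilde F).obj X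
  IsSheaf := hF.isSheaf X
  isLocalRing x := by
    have := hF.isLocalHom_stalkMap_tildeIncl X x
    exact @RingHom.domain_isLocalRing _ _ _ _ (X.left.toLocallyRingedSpace.isLocalRing x)
      (PresheafedSpace.Hom.stalkMap ((tildeIncl F ε).app X) x).hom this

/-- The morphism `X → (|X|, F(𝒪_X))` of locally ringed spaces. -/
def tildeLRSIncl (X : Over (Spec k)) : X.left.toLocallyRingedSpace ⟶ tildeLRS hF X where
  toHom := (tildeIncl F ε).app X
  prop := hF.isLocalHom_stalkMap_tildeIncl X

/-- The morphism `(|X|, F(𝒪_X)) → (|Y|, F(𝒪_Y))` of locally ringed spaces induced by a morphism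
`X → Y` of schemes. -/
def tildeLRSMap {X Y : Over (Spec k)} (f : X ⟶ Y) : tildeLRS hF X ⟶ tildeLRS hF Y where
  toHom := (tilde F).map f
  prop x := by
    exact isLocalHom_stalkMap_of_comp ((tildeIncl F ε).app X) ((tilde F).map f) _
      ((tildeIncl F ε).naturality f).symm x ((f.left.toLRSHom ≫ tildeLRSIncl hF Y).prop x)

end LocallyRinged

/-! ### A criterion for affineness -/

theorem bijective_of_isLocalization {R S T : Type*} [CommRing R] [CommRing S] [CommRing T]
    [Algebra R S] [Algebra R T] (M : Submonoid R) [IsLocalization M S] [IsLocalization M T]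
    (f : S →+* T) (hf : f.comp (algebraMap R S) = algebraMap R T) : Function.Bijective f := by
  have h1 : f = (IsLocalization.algEquiv M S T : S →+* T) := by
    refine IsLocalization.ringHom_ext M (hf.trans (RingHom.ext fun x => ?_))
    exact ((IsLocalization.algEquiv M S T).commutes x).symm
  rw [h1]
  exact (IsLocalization.algEquiv M S T).bijective

/-- Once the spaces agree, the comparison of sheaves may be checked on basic opens, where both sides
are localizations of the global sections at the same element. -/
theorem isIso_toΓSpec (T : LocallyRingedSpace.{u}) (hT : IsHomeomorph T.toΓSpecFun)
    (hl : ∀ r : LocallyRingedSpace.Γ.obj (op T),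
      letI : Algebra (LocallyRingedSpace.Γ.obj (op T))
        (T.presheaf.obj (op (T.toΓSpecMapBasicOpen r))) :=
          (T.toToΓSpecMapBasicOpen r).hom.toAlgebra
      IsLocalization.Away r (T.presheaf.obj (op (T.toΓSpecMapBasicOpen r)))) :
    IsIso T.toΓSpec := by
  have h1 : IsIso T.toΓSpecBase :=
    (TopCat.isIso_iff_isHomeomorph _).2 hT
  have h2 : ∀ r : LocallyRingedSpace.Γ.obj (op T), IsIso (T.toΓSpecCApp r) := by
    intro r
    let : Algebra (LocallyRingedSpace.Γ.obj (op T))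
        (T.presheaf.obj (op (T.toΓSpecMapBasicOpen r))) :=
      (T.toToΓSpecMapBasicOpen r).hom.toAlgebra
    have := hl r
    have h3 := bijective_of_isLocalization (R := LocallyRingedSpace.Γ.obj (op T))
      (S := (structureSheafInType (LocallyRingedSpace.Γ.obj (op T))
        (LocallyRingedSpace.Γ.obj (op T))).obj.obj (op (PrimeSpectrum.basicOpen r)))
      (T := T.presheaf.obj (op (T.toΓSpecMapBasicOpen r))) (Submonoid.powers r)
      (T.toΓSpecCApp r).hom (congrArg CommRingCat.Hom.hom (T.toΓSpecCApp_spec r))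
    exact (ConcreteCategory.isIso_iff_bijective _).2 h3
  let φ : Spec.structureSheaf (LocallyRingedSpace.Γ.obj (op T)) ⟶
      (TopCat.Sheaf.pushforward _ T.toΓSpecBase).obj T.𝒪 := ⟨T.toΓSpecSheafedSpace.hom.c⟩
  have h3 : IsIso φ := by
    refine TopCat.Sheaf.isIso_iff_isIso_basis (B := PrimeSpectrum.basicOpen)
      PrimeSpectrum.isBasis_basic_opens fun r => ?_
    have := h2 r
    rw [← T.toΓSpecSheafedSpace_app_eq r] at this
    exact this
  have h4 : IsIso T.toΓSpecSheafedSpace.hom.c :=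
    Functor.map_isIso (TopCat.Sheaf.forget _ _) φ
  have h5 : IsIso T.toΓSpecSheafedSpace.hom.base := h1
  have h6 : IsIso T.toΓSpecSheafedSpace.hom := PresheafedSpace.isIso_of_components _
  have h7 : IsIso (SheafedSpace.forgetToPresheafedSpace.map T.toΓSpecSheafedSpace) := h6
  have h8 : IsIso T.toΓSpecSheafedSpace :=
    isIso_of_reflects_iso _ SheafedSpace.forgetToPresheafedSpace
  have h9 : IsIso (LocallyRingedSpace.forgetToSheafedSpace.map T.toΓSpec) := h8
  exact isIso_of_reflects_iso _ LocallyRingedSpace.forgetToSheafedSpace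

/-! ### The scheme structure on `(|X|, F(𝒪_X))`. -/

section TildeScheme

variable {k : CommRingCat.{u}} {F : Under k ⥤ CommRingCat.{u}} {ε : F ⟶ Under.forget k}
  (hF : IsThickening F ε)

include hF

theorem isUnit_germ_tilde_iff {X : Over (Spec k)} (x : X.left) {U : X.left.Opens} (hx : x ∈ U)
    (s : F.obj ((sectionsUnder X).obj (op U))) :
    IsUnit ((((tilde F).obj X).presheaf.germ U x hx).hom s) ↔
      x ∈ X.left.basicOpen (redSection ε X U s) := by
  rw [Scheme.mem_basicOpen _ _ _ hx]
  change _ ↔ IsUnit ((X.left.presheaf.germ U x hx).hom (redSection ε X U s))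
  rw [← stalkMap_tildeIncl_germ]
  have := hF.isLocalHom_stalkMap_tildeIncl X x
  exact ⟨fun h => h.map _, fun h => this.1 _ h⟩

theorem notMem_toΓSpecFun_tilde_iff {X : Over (Spec k)} (x : X.left)
    (s : LocallyRingedSpace.Γ.obj (op (tildeLRS hF X))) :
    s ∉ ((tildeLRS hF X).toΓSpecFun x).asIdeal ↔ x ∈ X.left.basicOpen (redSection ε X ⊤ s) :=
  (LocallyRingedSpace.notMem_prime_iff_unit_in_stalk _ s x).trans
    (isUnit_germ_tilde_iff hF x (Opens.mem_top x) s)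

theorem toΓSpecFun_tilde (X : Over (Spec k)) (x : X.left) :
    (tildeLRS hF X).toΓSpecFun x =
      PrimeSpectrum.comap (redSection ε X ⊤) (X.left.toLocallyRingedSpace.toΓSpecFun x) := by
  refine PrimeSpectrum.ext (Ideal.ext fun s => not_iff_not.1 ?_)
  rw [notMem_toΓSpecFun_tilde_iff, Scheme.mem_basicOpen _ _ _ (Opens.mem_top x)]
  exact (LocallyRingedSpace.notMem_prime_iff_unit_in_stalk X.left.toLocallyRingedSpace _ x).symm

/-- On points the map is `X → Spec Γ(X)` followed by `Spec` of a surjection with nil kernel, both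
homeomorphisms. On basic opens, `F` preserves the localization of `Γ(X)`. -/
theorem isIso_toΓSpec_tilde (X : Over (Spec k)) [IsAffine X.left] :
    IsIso (tildeLRS hF X).toΓSpec := by
  refine isIso_toΓSpec _ ?_ fun r => ?_
  · have h1 : IsHomeomorph X.left.toLocallyRingedSpace.toΓSpecFun :=
      X.left.toSpecΓ.homeomorph.isHomeomorph
    have h2 : IsHomeomorph (PrimeSpectrum.comap (redSection ε X ⊤)) :=
      PrimeSpectrum.isHomeomorph_comap _
        (fun x => ⟨1, one_pos, by
          rw [pow_one]
          exact hF.surjective ((sectionsUnder X).obj (op ⊤)) x⟩)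
        (fun x hx => hF.isNilpotent _ x hx)
    rw [funext (toΓSpecFun_tilde hF X)]
    exact h2.comp h1
  · have hU : (tildeLRS hF X).toΓSpecMapBasicOpen r = X.left.basicOpen (redSection ε X ⊤ r) :=
      TopologicalSpace.Opens.ext (Set.ext fun x => notMem_toΓSpecFun_tilde_iff hF x r)
    have h1 : ∀ (U : X.left.Opens), U = X.left.basicOpen (redSection ε X ⊤ r) →
        letI := (X.left.presheaf.map (homOfLE (le_top (a := U))).op).hom.toAlgebra
        IsLocalization.Away (redSection ε X ⊤ r) Γ(X.left, U) := by
      rintro _ rfl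
      exact (isAffineOpen_top X.left).isLocalization_basicOpen _
    exact hF.isLocalization_away ((sectionsUnder X).map (homOfLE le_top).op) r
      (redSection ε X ⊤ r) rfl (h1 _ hU)

/-- The topological map is unchanged, and `F` carries the isomorphisms on sections to isomorphisms.
This supplies the affine charts of the thickening. -/
theorem isOpenImmersion_tildeLRSMap {X Y : Over (Spec k)} (j : X ⟶ Y) [IsOpenImmersion j.left] :
    LocallyRingedSpace.IsOpenImmersion (tildeLRSMap hF j) where
  base_open := j.left.isOpenEmbedding
  c_iso U := by
    have h1 : IsIso ((Under.forget k).map ((sectionsUnderMap j).app (op (j.left ''ᵁ U)))) :=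
      PresheafedSpace.IsOpenImmersion.c_iso (f := j.left.toLRSHom.toHom) U
    have h2 : IsIso ((sectionsUnderMap j).app (op (j.left ''ᵁ U))) :=
      isIso_of_reflects_iso _ (Under.forget k)
    exact Functor.map_isIso F ((sectionsUnderMap j).app (op (j.left ''ᵁ U)))

/-- The scheme `(|X|, F(𝒪_X))`. -/
def tildeScheme (X : Over (Spec k)) : Scheme.{u} :=
  LocallyRingedSpace.IsOpenImmersion.scheme (tildeLRS hF X) fun x => by
    obtain ⟨V, hV, hx, -⟩ := exists_isAffineOpen_mem_and_subset (X := X.left) (x := x) (U := ⊤)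
      (Opens.mem_top _)
    let V' : Over (Spec k) := Over.mk (V.ι ≫ X.hom)
    let j : V' ⟶ X := Over.homMk V.ι
    have h1 : IsAffine V'.left := hV
    have h2 : IsOpenImmersion j.left := inferInstanceAs (IsOpenImmersion V.ι)
    have h3 := isOpenImmersion_tildeLRSMap hF j
    have h4 := isIso_toΓSpec_tilde hF V'
    -- The chart at `x` is the thickening of an affine open neighbourhood `V`, identified with the
    -- spectrum of its global sections.
    let g := CategoryTheory.inv (tildeLRS hF V').toΓSpec ≫ tildeLRSMap hF j
    refine ⟨_, g, ?_, ?_⟩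
    · let x' : V'.left := ⟨x, hx⟩
      refine ⟨(tildeLRS hF V').toΓSpec.base x', ?_⟩
      have h5 : (tildeLRS hF V').toΓSpec ≫
        CategoryTheory.inv (tildeLRS hF V').toΓSpec ≫ tildeLRSMap hF j = tildeLRSMap hF j := by
          rw [IsIso.hom_inv_id_assoc]
      exact congrArg (fun φ : tildeLRS hF V' ⟶ tildeLRS hF X => φ.base x') h5
    · exact inferInstanceAs (LocallyRingedSpace.IsOpenImmersion
        (CategoryTheory.inv (tildeLRS hF V').toΓSpec ≫ tildeLRSMap hF j))

/-- The morphism `(|X|, F(𝒪_X)) → (|Y|, F(𝒪_Y))` of schemes. -/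
def tildeSchemeMap {X Y : Over (Spec k)} (f : X ⟶ Y) : tildeScheme hF X ⟶ tildeScheme hF Y :=
  ⟨tildeLRSMap hF f⟩

/-- The morphism `X → (|X|, F(𝒪_X))` of schemes. -/
def tildeSchemeIncl (X : Over (Spec k)) : X.left ⟶ tildeScheme hF X :=
  ⟨tildeLRSIncl hF X⟩

theorem tildeSchemeIncl_naturality {X Y : Over (Spec k)} (f : X ⟶ Y) :
    tildeSchemeIncl hF X ≫ tildeSchemeMap hF f = f.left ≫ tildeSchemeIncl hF Y :=
  Scheme.Hom.ext' (LocallyRingedSpace.Hom.ext' ((tildeIncl F ε).naturality f).symm)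

theorem isAffine_tildeScheme (X : Over (Spec k)) [IsAffine X.left] : IsAffine (tildeScheme hF X) := by
  have h1 := isIso_toΓSpec_tilde hF X
  have h2 : IsIso (Scheme.forgetToLocallyRingedSpace.map (tildeScheme hF X).toSpecΓ) := h1
  exact ⟨isIso_of_reflects_iso _ Scheme.forgetToLocallyRingedSpace⟩

end TildeScheme

/-! ### Étale morphisms of thickenings and the cartesian square. -/

section TildeEtale

variable {k : CommRingCat.{u}} {F : Under k ⥤ CommRingCat.{u}} {ε : F ⟶ Under.forget k}
  (hF : IsThickening F ε)

/-- An open subset of `X`, as an open subset of `(|X|, F(𝒪_X))`. -/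
def tildeOpens {X : Over (Spec k)} (U : X.left.Opens) : (tildeScheme hF X).Opens := U

theorem isAffineOpen_tildeOpens {X : Over (Spec k)} {U : X.left.Opens} (hU : IsAffineOpen U) :
    IsAffineOpen (tildeOpens hF U) := by
  let V : Over (Spec k) := Over.mk (U.ι ≫ X.hom)
  let j : V ⟶ X := Over.homMk U.ι
  have h1 : IsAffine V.left := hU
  have h2 : IsOpenImmersion j.left := inferInstanceAs (IsOpenImmersion U.ι)
  have h3 : IsOpenImmersion (tildeSchemeMap hF j) := isOpenImmersion_tildeLRSMap hF j
  have h4 := isAffine_tildeScheme hF V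
  have h5 := isAffineOpen_opensRange (tildeSchemeMap hF j)
  have h6 : (tildeSchemeMap hF j).opensRange = tildeOpens hF U := by
    have h7 : U.ι.opensRange = U := U.opensRange_ι
    exact h7
  rwa [h6] at h5

/-- Local on source and target: affine opens of `X` and `Y` are affine in the thickenings, and on
them the ring map is `F` of an étale one. -/
theorem etale_tildeSchemeMap {X Y : Over (Spec k)} (f : X ⟶ Y) [Etale f.left] :
    Etale (tildeSchemeMap hF f) := by
  refine (HasRingHomProperty.iff_exists_appLE
    (RingHom.Etale.stableUnderComposition.stableUnderCompositionWithLocalizationAway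
      fun R S _ _ _ r _ => RingHom.etale_algebraMap.2 (Algebra.Etale.of_isLocalizationAway r)).1).2
    fun x => ?_
  obtain ⟨U, hU, hxU, -⟩ := exists_isAffineOpen_mem_and_subset (X := Y.left) (x := f.left x)
    (U := ⊤) (Opens.mem_top _)
  obtain ⟨V, hV, hxV, e⟩ := exists_isAffineOpen_mem_and_subset (X := X.left) (x := x)
    (U := f.left ⁻¹ᵁ U) hxU
  refine ⟨⟨_, isAffineOpen_tildeOpens hF hU⟩, ⟨_, isAffineOpen_tildeOpens hF hV⟩, hxV, e, ?_⟩
  have h1 := hF.etale ((sectionsUnderMap f).app (op U) ≫ (sectionsUnder X).map (homOfLE e).op)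
    (f.left.etale_appLE hU hV e)
  rw [F.map_comp] at h1
  exact h1

instance isClosedImmersion_tildeSchemeIncl (X : Over (Spec k)) :
    IsClosedImmersion (tildeSchemeIncl hF X) where
  isClosedEmbedding := Topology.IsClosedEmbedding.id
  stalkMap_surjective x a := by
    obtain ⟨U, hx, s, rfl⟩ := X.left.presheaf.exists_germ_eq (x := x) a
    obtain ⟨s, rfl⟩ := hF.surjective ((sectionsUnder X).obj (op U)) s
    exact ⟨(((tilde F).obj X).presheaf.germ U x hx).hom s, stalkMap_tildeIncl_germ x hx s⟩

/-- The map `v` from `X` to the fibre product is étale, both being étale over `Y`, and a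
monomorphism, since `X` is closed in its thickening. It is surjective because the fibre product
injects into the thickening, whose points are those of `X`. An étale monomorphism is an open
immersion, and a surjective one is an isomorphism. -/
theorem isPullback_tildeScheme {X Y : Over (Spec k)} (f : X ⟶ Y) [Etale f.left] :
    IsPullback (tildeSchemeIncl hF X) f.left (tildeSchemeMap hF f) (tildeSchemeIncl hF Y) := by
  have := etale_tildeSchemeMap hF f
  have w := tildeSchemeIncl_naturality hF f
  let v : X.left ⟶ Limits.pullback (tildeSchemeMap hF f) (tildeSchemeIncl hF Y) :=
    Limits.pullback.lift _ _ w
  have h1 : v ≫ Limits.pullback.fst _ _ = tildeSchemeIncl hF X := Limits.pullback.lift_fst ..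
  have h2 : v ≫ Limits.pullback.snd _ _ = f.left := Limits.pullback.lift_snd ..
  have h3 : Etale (v ≫ Limits.pullback.snd (tildeSchemeMap hF f) (tildeSchemeIncl hF Y)) := by
    rwa [h2]
  have h4 : Etale v := Etale.of_comp v (Limits.pullback.snd _ _)
  have h5 : Mono (v ≫ Limits.pullback.fst (tildeSchemeMap hF f) (tildeSchemeIncl hF Y)) := by
    rw [h1]
    infer_instance
  have h6 : Mono v := mono_of_mono v (Limits.pullback.fst _ _)
  have h7 : Surjective v := ⟨fun y => by
    let x : X.left := Limits.pullback.fst (tildeSchemeMap hF f) (tildeSchemeIncl hF Y) y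
    refine ⟨x, (Limits.pullback.fst (tildeSchemeMap hF f)
      (tildeSchemeIncl hF Y)).isClosedEmbedding.injective ?_⟩
    rw [← Scheme.Hom.comp_apply, h1]
    rfl⟩
  have h8 : IsOpenImmersion v := IsOpenImmersion.of_flat_of_mono v
  have h9 : IsIso v := (isIso_iff_isOpenImmersion_and_surjective v).2 ⟨h8, h7⟩
  exact IsPullback.of_iso_pullback ⟨w⟩ (asIso v) h1 h2

variable {X Y : Over (Spec k)} {X' Y' : Scheme.{u}}
  (α : schemeToPresheafedSpace.obj X' ≅ (tilde F).obj X)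
  (β : schemeToPresheafedSpace.obj Y' ≅ (tilde F).obj Y)

theorem isLocalHom_stalkMap_of_isIso {S T : PresheafedSpace.{_, _, u} CommRingCat.{u}}
    (φ : S ⟶ T) [IsIso φ] (x : S) : IsLocalHom (PresheafedSpace.Hom.stalkMap φ x).hom :=
  isLocalHom_of_isIso _

/-- A scheme with underlying ringed space `(|X|, F(𝒪_X))` is isomorphic to the scheme constructed
above. -/
def isoTildeScheme : X' ≅ tildeScheme hF X where
  hom := ⟨⟨α.hom, isLocalHom_stalkMap_of_isIso α.hom⟩⟩
  inv := ⟨⟨α.inv, isLocalHom_stalkMap_of_isIso α.inv⟩⟩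
  hom_inv_id := Scheme.Hom.ext' (LocallyRingedSpace.Hom.ext' α.hom_inv_id)
  inv_hom_id := Scheme.Hom.ext' (LocallyRingedSpace.Hom.ext' α.inv_hom_id)

include hF in
-- An isomorphism of ringed spaces is automatically local on stalks, so the result transfers to any
-- schemes that realize the two ringed spaces.
theorem exists_isPullback (f : X ⟶ Y) [Etale f.left] :
    ∃ (f' : X' ⟶ Y') (i : X.left ⟶ X') (j : Y.left ⟶ Y'),
      schemeToPresheafedSpace.map f' ≫ β.hom = α.hom ≫ (tilde F).map f ∧
      schemeToPresheafedSpace.map i ≫ α.hom = (tildeIncl F ε).app X ∧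
      schemeToPresheafedSpace.map j ≫ β.hom = (tildeIncl F ε).app Y ∧
      Etale f' ∧ IsPullback i f.left f' j := by
  have := etale_tildeSchemeMap hF f
  refine ⟨(isoTildeScheme hF α).hom ≫ tildeSchemeMap hF f ≫ (isoTildeScheme hF β).inv,
    tildeSchemeIncl hF X ≫ (isoTildeScheme hF α).inv,
    tildeSchemeIncl hF Y ≫ (isoTildeScheme hF β).inv, ?_, ?_, ?_, inferInstance, ?_⟩
  · change (α.hom ≫ (tilde F).map f ≫ β.inv) ≫ β.hom = _
    rw [Category.assoc, Category.assoc, Iso.inv_hom_id, Category.comp_id]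
  · change ((tildeIncl F ε).app X ≫ α.inv) ≫ α.hom = _
    rw [Category.assoc, Iso.inv_hom_id, Category.comp_id]
  · change ((tildeIncl F ε).app Y ≫ β.inv) ≫ β.hom = _
    rw [Category.assoc, Iso.inv_hom_id, Category.comp_id]
  · refine (isPullback_tildeScheme hF f).of_iso (Iso.refl _) (isoTildeScheme hF α).symm
      (Iso.refl _) (isoTildeScheme hF β).symm ?_ ?_ ?_ ?_ <;> simp

end TildeEtale

/-! ### Equal characteristic -/

section EqualChar

variable {R : Type u} [CommRing R] [IsLocalRing R] (σ : IsLocalRing.ResidueField R →+* R)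
  (hσ : ∀ x, IsLocalRing.residue R (σ x) = x) (n : ℕ)
  {X Y : Over (Spec (CommRingCat.of (IsLocalRing.ResidueField R)))} (f : X ⟶ Y)

variable (X) in
/-- The projection `X ×_{Spec k} Spec (R / 𝔪 ^ (n + 1)) → X`. -/
def equalTildeFst : (equalTilde σ n).obj X ⟶ X.left :=
  Limits.pullback.fst X.hom (coeffSpec σ n)

variable (X) in
/-- The projection `X ×_{Spec k} Spec (R / 𝔪 ^ (n + 1)) → Spec (R / 𝔪 ^ (n + 1))`. -/
def equalTildeSnd : (equalTilde σ n).obj X ⟶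
    Spec (CommRingCat.of (R ⧸ IsLocalRing.maximalIdeal R ^ (n + 1))) :=
  Limits.pullback.snd X.hom (coeffSpec σ n)

variable (X) in
theorem isPullback_equalTilde :
    IsPullback (equalTildeSnd σ n X) (equalTildeFst σ n X) (coeffSpec σ n) X.hom :=
  (IsPullback.of_hasPullback X.hom (coeffSpec σ n)).flip

theorem equalTilde_map_fst :
    (equalTilde σ n).map f ≫ equalTildeFst σ n Y = equalTildeFst σ n X ≫ f.left :=
  Limits.pullback.lift_fst ..

theorem equalTilde_map_snd :
    (equalTilde σ n).map f ≫ equalTildeSnd σ n Y = equalTildeSnd σ n X :=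
  Limits.pullback.lift_snd ..

theorem isPullback_equalTilde_map :
    IsPullback ((equalTilde σ n).map f) (equalTildeFst σ n X) (equalTildeFst σ n Y) f.left := by
  refine IsPullback.of_right (h₁₂ := equalTildeSnd σ n Y) ?_ (equalTilde_map_fst σ n f)
    (isPullback_equalTilde σ n Y)
  rw [equalTilde_map_snd, Over.w]
  exact isPullback_equalTilde σ n X

variable (X) in
theorem equalTildeIncl_fst : equalTildeIncl σ hσ n X ≫ equalTildeFst σ n X = 𝟙 _ :=
  Limits.pullback.lift_fst ..

variable (X) in
theorem equalTildeIncl_snd :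
    equalTildeIncl σ hσ n X ≫ equalTildeSnd σ n X = X.hom ≫ residueSpec R n :=
  Limits.pullback.lift_snd ..

theorem equalTildeIncl_naturality : equalTildeIncl σ hσ n X ≫ (equalTilde σ n).map f =
    f.left ≫ equalTildeIncl σ hσ n Y := by
  refine (isPullback_equalTilde σ n Y).hom_ext ?_ ?_
  · rw [Category.assoc, Category.assoc, equalTilde_map_snd, equalTildeIncl_snd,
      equalTildeIncl_snd, Over.w_assoc]
  · rw [Category.assoc, Category.assoc, equalTilde_map_fst, equalTildeIncl_fst,
      ← Category.assoc, equalTildeIncl_fst, Category.id_comp, Category.comp_id]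

/-- Pasting with the cartesian square of the projections to `X` and `Y`: the outer rectangle has
identities as horizontal maps. -/
theorem isPullback_equalTildeIncl :
    IsPullback (equalTildeIncl σ hσ n X) f.left ((equalTilde σ n).map f)
      (equalTildeIncl σ hσ n Y) := by
  refine IsPullback.of_right (h₁₂ := equalTildeFst σ n X) ?_
    (equalTildeIncl_naturality σ hσ n f) (isPullback_equalTilde_map σ n f).flip
  rw [equalTildeIncl_fst, equalTildeIncl_fst]
  exact IsPullback.of_horiz_isIso ⟨by rw [Category.id_comp, Category.comp_id]⟩

end EqualChar

end Greenberg

end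

theorem mainTheorem8 (R : Type u) [CommRing R] [IsDomain R] [IsDiscreteValuationRing R]
    [IsAdicComplete (IsLocalRing.maximalIdeal R) R] (n : ℕ) :
    -- mixed characteristic
    (∀ (p : ℕ) [Fact p.Prime] [CharZero R] [CharP (IsLocalRing.ResidueField R) p]
        [PerfectRing (IsLocalRing.ResidueField R) p],
      (∀ X : Over (Spec (CommRingCat.of (IsLocalRing.ResidueField R))),
        ∃ (X' : Scheme.{u}) (_ : Greenberg.schemeToPresheafedSpace.obj X' ≅
            (Greenberg.tilde (Greenberg.wittFunctor p R n)).obj X),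
          IsAffine X.left → IsAffine X') ∧
      ∀ (X Y : Over (Spec (CommRingCat.of (IsLocalRing.ResidueField R)))) (f : X ⟶ Y),
        Etale f.left →
        ∀ (X' Y' : Scheme.{u})
          (α : Greenberg.schemeToPresheafedSpace.obj X' ≅
            (Greenberg.tilde (Greenberg.wittFunctor p R n)).obj X)
          (β : Greenberg.schemeToPresheafedSpace.obj Y' ≅
            (Greenberg.tilde (Greenberg.wittFunctor p R n)).obj Y),
          ∃ (f' : X' ⟶ Y') (i : X.left ⟶ X') (j : Y.left ⟶ Y'),
            Greenberg.schemeToPresheafedSpace.map f' ≫ β.hom =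
              α.hom ≫ (Greenberg.tilde (Greenberg.wittFunctor p R n)).map f ∧
            Greenberg.schemeToPresheafedSpace.map i ≫ α.hom =
              (Greenberg.tildeIncl _ (Greenberg.wittReduction p R n)).app X ∧
            Greenberg.schemeToPresheafedSpace.map j ≫ β.hom =
              (Greenberg.tildeIncl _ (Greenberg.wittReduction p R n)).app Y ∧
            Etale f' ∧ IsPullback i f.left f' j) ∧
    -- equal characteristic
    (∀ (σ : IsLocalRing.ResidueField R →+* R) (hσ : ∀ x, IsLocalRing.residue R (σ x) = x)
        (X Y : Over (Spec (CommRingCat.of (IsLocalRing.ResidueField R)))) (f : X ⟶ Y),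
      Etale f.left →
        Etale ((Greenberg.equalTilde σ n).map f) ∧
        IsPullback (Greenberg.equalTildeIncl σ hσ n X) f.left
          ((Greenberg.equalTilde σ n).map f) (Greenberg.equalTildeIncl σ hσ n Y)) := by
  refine ⟨fun p _ _ _ _ => ?_, fun σ hσ X Y f hf => ?_⟩
  · have hF := Greenberg.isThickening_wittFunctor p R n
    refine ⟨fun X => ⟨Greenberg.tildeScheme hF X, Iso.refl _, fun _ =>
      Greenberg.isAffine_tildeScheme hF X⟩, fun X Y f hf X' Y' α β => ?_⟩
    exact Greenberg.exists_isPullback hF α β f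
  · exact ⟨MorphismProperty.of_isPullback (P := @Etale)
      (Greenberg.isPullback_equalTilde_map σ n f).flip hf,
      Greenberg.isPullback_equalTildeIncl σ hσ n f⟩
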